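/- Let $X$ be a complex manifold of dimension $N=p+n$, let $Z\subset X$ be a (not necessarily reduced) analytic subspace with coherent ideal sheaf $\mathcal J\subset\mathcal O_X$, so that $\mathcal O_Z=\mathcal O_X/\mathcal J$, and let $W=Z_{\rm red}$ be its zero set. Suppose that on some open set $D\subset X$ there are holomorphic coordinates $(z,w)\in\mathbb C^p\times\mathbb C^n$ in which $W\cap D=\{z_1=\dots=z_p=0\}$. For $\zeta\in W\cap D$ the ring $\mathcal O_{W,\zeta}$ is the ring of germs of holomorphic functions of $w$ at $w(\zeta)$, and $\mathcal O_{X,\zeta}$ and $\mathcal O_{Z,\zeta}$ are $\mathcal O_{W,\zeta}$-algebras through the projection $(z,w)\mapsto w$. Let $\zeta\in W\cap D$ be a point such that $\mathcal O_{Z,\zeta}$ is a free $\mathcal O_{W,\zeta}$-module with a basis of monomials $z^{\alpha^1},\dots,z^{\alpha^m}$, where $\alpha^1,\dots,\alpha^m\in\mathbb N_{\ge 0}^p$. Let $$A=\mathcal O_{X,\zeta}\otimes_{\mathcal O_{W,\zeta}}\mathcal O_{Z,\zeta},\qquad \mathbf z_i=z_i\otimes 1-1\otimes z_i\in A\quad(i=1,\dots,p),$$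 and regard $\mathcal O_{Z,\zeta}$ as an $A$-module through the ring homomorphism $A\to\mathcal O_{Z,\zeta}$, $f\otimes g\mapsto fg$. Then the Koszul complex $(\bigwedge^\bullet A^{\oplus p},\delta_{\mathbf z})$ of $\mathbf z=(\mathbf z_1,\dots,\mathbf z_p)$, where $\delta_{\mathbf z}$ is contraction with $\sum_i \mathbf z_i e_i^*$, augmented by the map $\bigwedge^0A^{\oplus p}=A\to\mathcal O_{Z,\zeta}$, $f\otimes g\mapsto fg$, is a resolution of $\mathcal O_{Z,\zeta}$ by free modules of finite rank, both over $A$ and over $\mathcal O_{X,\zeta}$. -/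

import Mathlib

open scoped Manifold Topology TensorProduct
open Filter

noncomputable section

/-! ### Germs of holomorphic functions -/

section Germs

variable {E : Type*} [NormedAddCommGroup E] [NormedSpace ℂ E]
  {X : Type*} [TopologicalSpace X] [ChartedSpace E X]

/-- The local ring `𝒪_{X,x}` of germs at `x` of holomorphic functions on the complex manifold `X`
(modelled on the complex vector space `E`). -/
def holGerm (E : Type*) [NormedAddCommGroup E] [NormedSpace ℂ E]
    {X : Type*} [TopologicalSpace X] [ChartedSpace E X] (x : X) :
    Subring (Germ (𝓝 x) ℂ) where
  carrier := {g | ∃ f : X → ℂ, g = (f : Germ (𝓝 x) ℂ) ∧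
    ∀ᶠ y in 𝓝 x, MDifferentiableAt 𝓘(ℂ, E) 𝓘(ℂ, ℂ) f y}
  mul_mem' := by
    rintro _ _ ⟨f, rfl, hf⟩ ⟨g, rfl, hg⟩
    refine ⟨f * g, rfl, ?_⟩
    filter_upwards [hf, hg] with y h₁ h₂ using h₁.mul h₂
  add_mem' := by
    rintro _ _ ⟨f, rfl, hf⟩ ⟨g, rfl, hg⟩
    refine ⟨f + g, rfl, ?_⟩
    filter_upwards [hf, hg] with y h₁ h₂ using h₁.add h₂
  one_mem' := ⟨fun _ => 1, rfl, Eventually.of_forall fun _ => mdifferentiableAt_const⟩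
  zero_mem' := ⟨fun _ => 0, rfl, Eventually.of_forall fun _ => mdifferentiableAt_const⟩
  neg_mem' := by
    rintro _ ⟨f, rfl, hf⟩
    refine ⟨-f, rfl, ?_⟩
    filter_upwards [hf] with y h using h.neg

/-- The local ring `𝒪_{X,x}` as a type. -/
def HolRing (E : Type*) [NormedAddCommGroup E] [NormedSpace ℂ E]
    {X : Type*} [TopologicalSpace X] [ChartedSpace E X] (x : X) : Type _ :=
  holGerm E x

instance (x : X) : CommRing (HolRing E x) :=
  inferInstanceAs (CommRing (holGerm E x))

/-- An element of `𝒪_{X,x}` as a germ of a function. -/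
def HolRing.germ {x : X} (g : HolRing E x) : Germ (𝓝 x) ℂ := g.1

/-- The germ at `x` of a function that is holomorphic near `x`. -/
def germOf (f : X → ℂ) (x : X)
    (hf : ∀ᶠ y in 𝓝 x, MDifferentiableAt 𝓘(ℂ, E) 𝓘(ℂ, ℂ) f y) : HolRing E x :=
  ⟨(f : Germ (𝓝 x) ℂ), f, rfl, hf⟩

/-- Pull-back of germs of holomorphic functions along a map `h : X → X'` that is holomorphic
near `x`. -/
def holGermPullback {E' : Type*} [NormedAddCommGroup E'] [NormedSpace ℂ E']
    {X' : Type*} [TopologicalSpace X'] [ChartedSpace E' X'] (h : X → X') (x : X)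
    (hh : ∀ᶠ y in 𝓝 x, MDifferentiableAt 𝓘(ℂ, E) 𝓘(ℂ, E') h y) :
    HolRing E' (h x) →+* HolRing E x where
  toFun g := ⟨g.germ.compTendsto h hh.self_of_nhds.continuousAt, by
    obtain ⟨_, f, rfl, hf⟩ := g
    refine ⟨f ∘ h, rfl, ?_⟩
    filter_upwards [hh, hh.self_of_nhds.continuousAt.eventually hf] with y h₁ h₂
    exact h₂.comp y h₁⟩
  map_one' := rfl
  map_zero' := rfl
  map_mul' := by
    rintro ⟨_, f, rfl, hf⟩ ⟨_, g, rfl, hg⟩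
    rfl
  map_add' := by
    rintro ⟨_, f, rfl, hf⟩ ⟨_, g, rfl, hg⟩
    rfl

end Germs

/-! ### Analytic subspaces and local coordinates -/

section Geometry

/-- A (not necessarily reduced) closed analytic subspace `Z` of the complex manifold `X`, given by
its ideal sheaf `𝒥`: a family of ideals `𝒥_x ⊆ 𝒪_{X,x}` which near every point is generated by
finitely many holomorphic functions. -/
structure AnalyticSubspace (E : Type*) [NormedAddCommGroup E] [NormedSpace ℂ E]
    (X : Type*) [TopologicalSpace X] [ChartedSpace E X] where
  ideal : ∀ x : X, Ideal (HolRing E x)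
  locally_generated : ∀ x : X, ∃ V : Set X, IsOpen V ∧ x ∈ V ∧
    ∃ (r : ℕ) (f : Fin r → X → ℂ),
      (∀ j, MDifferentiableOn 𝓘(ℂ, E) 𝓘(ℂ, ℂ) (f j) V) ∧
      ∀ y ∈ V, ideal y =
        Ideal.span {g | ∃ j, g.germ = (f j : Germ (𝓝 y) ℂ)}

variable {E : Type*} [NormedAddCommGroup E] [NormedSpace ℂ E]
  {X : Type*} [TopologicalSpace X] [ChartedSpace E X]

/-- The set of points of `Z_red`: the common zero set of the ideal sheaf. -/
def AnalyticSubspace.zeroSet (Z : AnalyticSubspace E X) : Set X :=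
  {x | ∀ g ∈ Z.ideal x, g.germ.value = 0}

/-- The local ring `𝒪_{Z,x} = 𝒪_{X,x} / 𝒥_x`. -/
def AnalyticSubspace.localRing (Z : AnalyticSubspace E X) (x : X) : Type _ :=
  HolRing E x ⧸ Z.ideal x

instance (Z : AnalyticSubspace E X) (x : X) : CommRing (Z.localRing x) :=
  inferInstanceAs (CommRing (HolRing E x ⧸ Z.ideal x))

instance (Z : AnalyticSubspace E X) (x : X) : Algebra (HolRing E x) (Z.localRing x) :=
  inferInstanceAs (Algebra (HolRing E x) (HolRing E x ⧸ Z.ideal x))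

/-- Holomorphic coordinates `(z, w)` with values in `ℂ^p × ℂ^n` on an open subset of `X`:
a biholomorphic map onto an open subset of `ℂ^p × ℂ^n`. -/
structure HolCoordinates (E : Type*) [NormedAddCommGroup E] [NormedSpace ℂ E]
    (X : Type*) [TopologicalSpace X] [ChartedSpace E X] (p n : ℕ) where
  chart : OpenPartialHomeomorph X ((Fin p → ℂ) × (Fin n → ℂ))
  holo : MDifferentiableOn 𝓘(ℂ, E) 𝓘(ℂ, (Fin p → ℂ) × (Fin n → ℂ)) chart chart.source
  holo_symm : MDifferentiableOn 𝓘(ℂ, (Fin p → ℂ) × (Fin n → ℂ)) 𝓘(ℂ, E) chart.symm chart.target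

namespace HolCoordinates

variable {p n : ℕ} (φ : HolCoordinates E X p n)

/-- The coordinates `z : X → ℂ^p`. -/
def z (x : X) : Fin p → ℂ := (φ.chart x).1

/-- The coordinates `w : X → ℂ^n`. -/
def w (x : X) : Fin n → ℂ := (φ.chart x).2

theorem eventually_holo (x : φ.chart.source) : ∀ᶠ y in 𝓝 (x : X),
    MDifferentiableAt 𝓘(ℂ, E) 𝓘(ℂ, (Fin p → ℂ) × (Fin n → ℂ)) φ.chart y := by
  filter_upwards [φ.chart.open_source.mem_nhds x.2] with y hy
  exact (φ.holo y hy).mdifferentiableAt (φ.chart.open_source.mem_nhds hy)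

theorem eventually_holo_z (x : φ.chart.source) (i : Fin p) : ∀ᶠ y in 𝓝 (x : X),
    MDifferentiableAt 𝓘(ℂ, E) 𝓘(ℂ, ℂ) (fun y => φ.z y i) y := by
  filter_upwards [φ.eventually_holo x] with y hy
  have h : DifferentiableAt ℂ
      (fun v : (Fin p → ℂ) × (Fin n → ℂ) => v.1 i) (φ.chart y) := by fun_prop
  exact h.mdifferentiableAt.comp y hy

theorem eventually_holo_w (x : φ.chart.source) : ∀ᶠ y in 𝓝 (x : X),
    MDifferentiableAt 𝓘(ℂ, E) 𝓘(ℂ, Fin n → ℂ) φ.w y := by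
  filter_upwards [φ.eventually_holo x] with y hy
  have h : DifferentiableAt ℂ
      (fun v : (Fin p → ℂ) × (Fin n → ℂ) => v.2) (φ.chart y) := by fun_prop
  exact h.mdifferentiableAt.comp y hy

/-- The coordinate function `z_i` as an element of `𝒪_{X,x}`. -/
def zGerm (x : φ.chart.source) (i : Fin p) : HolRing E (x : X) :=
  germOf (fun y => φ.z y i) x (φ.eventually_holo_z x i)

/-- The monomial `z^α = z_1^{α_1} ⋯ z_p^{α_p}` as an element of `𝒪_{X,x}`. -/
def monomial (x : φ.chart.source) (α : Fin p → ℕ) : HolRing E (x : X) :=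
  ∏ i, φ.zGerm x i ^ α i

/-- The local ring `𝒪_{W,x}` of the submanifold `W = {z = 0}` at a point `x` of `W`. Since `w` is a
coordinate system on `W`, it is the ring of germs at `w(x)` of holomorphic functions of
`w ∈ ℂ^n`. -/
def baseRing (x : φ.chart.source) : Type :=
  HolRing (Fin n → ℂ) (φ.w x)

instance (x : φ.chart.source) : CommRing (φ.baseRing x) :=
  inferInstanceAs (CommRing (HolRing (Fin n → ℂ) (φ.w x)))

/-- `𝒪_{X,x}` is an `𝒪_{W,x}`-algebra through the projection `(z, w) ↦ w`. -/
instance (x : φ.chart.source) : Algebra (φ.baseRing x) (HolRing E (x : X)) :=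
  (holGermPullback φ.w (x : X) (φ.eventually_holo_w x)).toAlgebra

/-- `𝒪_{Z,x}` is an `𝒪_{W,x}`-algebra through `𝒪_{W,x} → 𝒪_{X,x} → 𝒪_{Z,x}`. -/
instance (Z : AnalyticSubspace E X) (x : φ.chart.source) :
    Algebra (φ.baseRing x) (Z.localRing (x : X)) :=
  ((algebraMap (HolRing E (x : X)) (Z.localRing (x : X))).comp
    (algebraMap (φ.baseRing x) (HolRing E (x : X)))).toAlgebra

instance (Z : AnalyticSubspace E X) (x : φ.chart.source) :
    IsScalarTower (φ.baseRing x) (HolRing E (x : X)) (Z.localRing (x : X)) :=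
  IsScalarTower.of_algebraMap_eq fun _ => rfl

end HolCoordinates

variable {p n : ℕ} (Z : AnalyticSubspace E X) (φ : HolCoordinates E X p n)
  (x : φ.chart.source)

/-- The ring `A = 𝒪_{X,x} ⊗_{𝒪_{W,x}} 𝒪_{Z,x}`. -/
def ringA : Type _ :=
  HolRing E (x : X) ⊗[φ.baseRing x] Z.localRing (x : X)

instance : CommRing (ringA Z φ x) :=
  inferInstanceAs (CommRing (HolRing E (x : X) ⊗[φ.baseRing x] Z.localRing (x : X)))

/-- `A` as an `𝒪_{X,x}`-algebra, through `f ↦ f ⊗ 1`. -/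
instance : Algebra (HolRing E (x : X)) (ringA Z φ x) :=
  inferInstanceAs
    (Algebra (HolRing E (x : X)) (HolRing E (x : X) ⊗[φ.baseRing x] Z.localRing (x : X)))

/-- The ring homomorphism `A → 𝒪_{Z,x}`, `f ⊗ g ↦ f g`. -/
def ringA.toLocalRing : ringA Z φ x →ₐ[HolRing E (x : X)] Z.localRing (x : X) :=
  Algebra.TensorProduct.lift (Algebra.ofId (HolRing E (x : X)) (Z.localRing (x : X)))
    (AlgHom.id (φ.baseRing x) (Z.localRing (x : X))) fun _ _ => Commute.all _ _

/-- `𝒪_{Z,x}` as a module over `A`, through `f ⊗ g ↦ f g`. -/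
instance : Module (ringA Z φ x) (Z.localRing (x : X)) :=
  Module.compHom _ (ringA.toLocalRing Z φ x).toRingHom

instance : IsScalarTower (HolRing E (x : X)) (ringA Z φ x) (Z.localRing (x : X)) where
  smul_assoc f a g := by
    change ringA.toLocalRing Z φ x (f • a) * g = f • (ringA.toLocalRing Z φ x a * g)
    rw [map_smul, smul_mul_assoc]

/-- The map `f ⊗ g ↦ f g` as an `A`-linear map. -/
def ringA.augmentation : ringA Z φ x →ₗ[ringA Z φ x] Z.localRing (x : X) :=
  LinearMap.toSpanSingleton _ _ 1

/-- The elements `𝐳_i = z_i ⊗ 1 - 1 ⊗ z_i` of `A`. -/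
def boldZ (i : Fin p) : ringA Z φ x :=
  ((φ.zGerm x i ⊗ₜ 1 - 1 ⊗ₜ algebraMap _ _ (φ.zGerm x i) :
    HolRing E (x : X) ⊗[φ.baseRing x] Z.localRing (x : X)))

end Geometry

/-! ### Koszul complexes and free resolutions -/

section Koszul

theorem contractLeft_mem_exteriorPower {R M : Type*} [CommRing R] [AddCommGroup M] [Module R M]
    (d : Module.Dual R M) (k : ℕ) (a : ExteriorAlgebra R M) (ha : a ∈ ⋀[R]^(k + 1) M) :
    CliffordAlgebra.contractLeft d a ∈ ⋀[R]^k M := by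
  induction k generalizing a with
  | zero =>
    rw [ExteriorAlgebra.exteriorPower, zero_add, pow_one] at ha
    obtain ⟨v, rfl⟩ := ha
    rw [ExteriorAlgebra.exteriorPower, pow_zero]
    exact Submodule.mem_one.2 ⟨d v, (CliffordAlgebra.contractLeft_ι _ d v).symm⟩
  | succ k ih =>
    rw [ExteriorAlgebra.exteriorPower, pow_succ'] at ha
    induction ha using Submodule.mul_induction_on' with
    | mem_mul_mem u hu b hb =>
      obtain ⟨v, rfl⟩ := hu
      have h := CliffordAlgebra.contractLeft_ι_mul (Q := (0 : QuadraticForm R M)) d v b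
      refine h ▸ sub_mem (Submodule.smul_mem _ _ hb) ?_
      rw [ExteriorAlgebra.exteriorPower, pow_succ']
      exact Submodule.mul_mem_mul ⟨v, rfl⟩ (ih b hb)
    | add a _ b _ ha hb => rw [map_add]; exact add_mem ha hb

/-- The differential `δ_x : ⋀^{k+1} R^p → ⋀^k R^p` of the Koszul complex of `x = (x_1, …, x_p)`:
contraction with the linear form `∑ x_i e_i^*`, so that `e_{I_0} ∧ ⋯ ∧ e_{I_k}` goes to
`∑_i (-1)^i x_{I_i} e_{I ∖ I_i}`. -/
def koszulDifferential {R : Type*} [CommRing R] {p : ℕ} (x : Fin p → R) (k : ℕ) :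
    ⋀[R]^(k + 1) (Fin p → R) →ₗ[R] ⋀[R]^k (Fin p → R) :=
  (CliffordAlgebra.contractLeft (Q := (0 : QuadraticForm R (Fin p → R)))
      (∑ i, x i • LinearMap.proj i)).restrict
    (contractLeft_mem_exteriorPower _ k)

/-- The sequence `⋯ → K_2 → K_1 → K_0 → M → 0`, with differentials `d` and augmentation `ε`, is a
resolution of the `R`-module `M` by free modules of finite rank. -/
structure IsFreeResolution (R : Type*) [CommRing R] (K : ℕ → Type*)
    [∀ k, AddCommGroup (K k)] [∀ k, Module R (K k)] {M : Type*} [AddCommGroup M] [Module R M]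
    (d : ∀ k, K (k + 1) →ₗ[R] K k) (ε : K 0 →ₗ[R] M) : Prop where
  free : ∀ k, Module.Free R (K k)
  finite : ∀ k, Module.Finite R (K k)
  exact : ∀ k, Function.Exact (d (k + 1)) (d k)
  exact_zero : Function.Exact (d 0) ε
  surjective : Function.Surjective ε

end Koszul

end

/-! Write `R`, `S`, `B` for the local rings of `W`, `X`, `Z` at `ζ`, so that `A = S ⊗[R] B`. The
core of the proof is that `A` admits unique division by each `𝐳_i`, with a remainder that does not
involve the variable `z_i` of the first factor.

Multiplication by `z_i` on the finite free `R`-module `B` has a characteristic polynomial `P_i`,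
which annihilates `z_i` in `B` by Cayley–Hamilton. Since `c - z_i` is a unit for every constant `c ≠
0`, the reduction of `P_i` at the base point is a power of the variable
(`exists_monic_aeval_eq_zero`). So `P_i(z_i)` is a Weierstrass polynomial in `S`, and Weierstrass
division by it holds with existence and uniqueness (`exists_division`, `eq_zero_of_division`). It is
proved here with Cauchy integrals. Modulo `𝐳_i` the elements `z_i ⊗ 1` and `1 ⊗ z_i` agree and
`P_i(z_i) ⊗ 1` vanishes, which turns division by `P_i(z_i)` in `S` into division by `𝐳_i` in `A`
(`exists_fixed_sub_mul_tmul_sub`, `eq_zero_of_tmul_sub_mul_fixed`).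

The quotient of this division is an additive operator `T_i` with `T_i(𝐳_i a) = a` that commutes with
`𝐳_j` for `j ≠ i`. Then `e_i ∧ T_i` is a homotopy, on cycles, from the identity to an operator `π_i`
that kills all multiples of `e_i`. The product of all `π_i` is zero in positive degrees, so the
Koszul complex is exact there (`koszulDifferential_exact`). In degree zero, dividing successively by
all `𝐳_i` leaves a remainder free of every `z_i`, that is, an element `1 ⊗ c`; the augmentation
sends it to `c`, so its kernel is the ideal of the `𝐳_i`. Finally `A` is free of finite rank over
`S`, with basis induced from that of `B`, which gives the statement over `S`. -/

/-! ### Holomorphic dependence of circle integrals on parameters -/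

section ParametricCircleIntegral

open MeasureTheory Metric Set

variable {F : Type*} [NormedAddCommGroup F] [NormedSpace ℂ F] [FiniteDimensional ℂ F]

/-- A family of continuous linear forms on a finite-dimensional space is measurable as soon as its
values at all vectors are. -/
theorem aestronglyMeasurable_clm_of_apply {α : Type*} [MeasurableSpace α] {μ : Measure α}
    {L : α → F →L[ℂ] ℂ} (h : ∀ v, AEStronglyMeasurable (fun a => L a v) μ) :
    AEStronglyMeasurable L μ := by
  let b := Module.finBasis ℂ F
  have key : L = fun a => ∑ i, L a (b i) • LinearMap.toContinuousLinearMap (b.coord i) := by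
    funext a
    ext v
    have h := congrArg (L a) (b.sum_repr v)
    rw [map_sum] at h
    rw [← h]
    simp [mul_comm]
  rw [key]
  exact Finset.aestronglyMeasurable_fun_sum _ fun i _ => (h (b i)).smul_const _

/-- A circle integral depends holomorphically on parameters if the integrand does. -/
theorem differentiableAt_circleIntegral {H : ℂ × F → ℂ} {c : ℂ} {R : ℝ} {y₀ : F}
    (hH : ∀ s ∈ sphere c |R|, ∀ᶠ u in 𝓝 (s, y₀), DifferentiableAt ℂ H u) :
    DifferentiableAt ℂ (fun y => ∮ s in C(c, R), H (s, y)) y₀ := by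
  have hmem : ∀ θ : ℝ, circleMap c R θ ∈ sphere c |R| := circleMap_mem_sphere' c R
  -- a uniform neighbourhood on which `H` is holomorphic and bounded
  have h1 : ∀ s ∈ sphere c |R|, ∃ C : ℝ, ∀ᶠ u in 𝓝 (s, y₀), DifferentiableAt ℂ H u ∧ ‖H u‖ ≤ C := by
    intro s hs
    refine ⟨‖H (s, y₀)‖ + 1, (hH s hs).and ?_⟩
    have hc : ContinuousAt (fun u => ‖H u‖) (s, y₀) := (hH s hs).self_of_nhds.continuousAt.norm
    exact (hc.eventually (gt_mem_nhds (lt_add_one _))).mono fun u hu => hu.le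
  obtain ⟨C, r, hr, hbd⟩ : ∃ C : ℝ, ∃ r > 0, ∀ s ∈ sphere c |R|, ∀ y ∈ ball y₀ r,
      DifferentiableAt ℂ H (s, y) ∧ ‖H (s, y)‖ ≤ C := by
    -- The local bounds are made uniform by compactness of the circle.
    have key : ∃ C : ℝ, ∀ᶠ y in 𝓝 y₀, ∀ s ∈ sphere c |R|,
        DifferentiableAt ℂ H (s, y) ∧ ‖H (s, y)‖ ≤ C := by
      refine (isCompact_sphere c |R|).induction_on
        (p := fun S => ∃ C : ℝ, ∀ᶠ y in 𝓝 y₀, ∀ s ∈ S,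
          DifferentiableAt ℂ H (s, y) ∧ ‖H (s, y)‖ ≤ C) ⟨0, by simp⟩ ?_ ?_ ?_
      · rintro S T hST ⟨C, hC⟩
        exact ⟨C, hC.mono fun y hy s hs => hy s (hST hs)⟩
      · rintro S T ⟨C, hC⟩ ⟨C', hC'⟩
        refine ⟨max C C', (hC.and hC').mono ?_⟩
        rintro y ⟨h, h'⟩ s (hs | hs)
        · exact ⟨(h s hs).1, (h s hs).2.trans (le_max_left _ _)⟩
        · exact ⟨(h' s hs).1, (h' s hs).2.trans (le_max_right _ _)⟩
      · intro s hs
        obtain ⟨C, hC⟩ := h1 s hs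
        rw [nhds_prod_eq] at hC
        obtain ⟨p, hp, q, hq, hpq⟩ := eventually_prod_iff.1 hC
        exact ⟨{s | p s}, mem_nhdsWithin_of_mem_nhds hp, C,
          hq.mono fun y hy s hs => hpq hs hy⟩
    obtain ⟨C, hC⟩ := key
    obtain ⟨r, hr, h⟩ := Metric.eventually_nhds_iff_ball.1 hC
    exact ⟨C, r, hr, fun s hs y hy => h y hy s hs⟩
  have hdiff : ∀ s ∈ sphere c |R|, ∀ y ∈ ball y₀ r, DifferentiableAt ℂ (fun y => H (s, y)) y := by
    intro s hs y hy
    exact (hbd s hs y hy).1.comp y ((differentiableAt_const s).prodMk differentiableAt_id)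
  have hcont : ∀ y ∈ ball y₀ r, Continuous fun θ : ℝ => H (circleMap c R θ, y) := by
    intro y hy
    refine continuous_iff_continuousAt.2 fun θ => ?_
    exact ContinuousAt.comp (f := fun θ : ℝ => (circleMap c R θ, y))
      (hbd _ (hmem θ) y hy).1.continuousAt (by fun_prop)
  -- Cauchy estimate: on the ball of radius `r / 2` about `y` the function varies by at most `2 *
  -- C`. This gives the dominating bound for differentiation under the integral.
  have hder : ∀ s ∈ sphere c |R|, ∀ y ∈ ball y₀ (r / 2),
      ‖fderiv ℂ (fun y => H (s, y)) y‖ ≤ (2 * C) / (r / 2) := by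
    intro s hs y hy
    have hsub : ball y (r / 2) ⊆ ball y₀ r := by
      intro y' hy'
      rw [mem_ball] at *
      linarith [dist_triangle y' y y₀]
    refine Complex.norm_fderiv_le_div_of_mapsTo_ball
      (fun y' hy' => (hdiff s hs y' (hsub hy')).differentiableWithinAt) ?_ (half_pos hr)
    intro y' hy'
    have h1 := (hbd s hs y' (hsub hy')).2
    have h2 := (hbd s hs y (hsub (mem_ball_self (half_pos hr)))).2
    rw [mem_closedBall, dist_eq_norm]
    linarith [norm_sub_le (H (s, y')) (H (s, y))]
  have hy₀ : y₀ ∈ ball y₀ r := mem_ball_self hr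
  have hdc : Continuous (fun θ : ℝ => deriv (circleMap c R) θ) := by
    rw [funext fun θ => deriv_circleMap c R θ]
    fun_prop
  -- Each directional derivative is a pointwise limit of difference quotients that are continuous in
  -- `θ`, hence measurable in `θ`. The number `ε` is small enough to keep every `y₀ + t n • v` in
  -- the ball.
  have hfd : ∀ v, AEStronglyMeasurable
      (fun θ : ℝ => fderiv ℂ (fun y => H (circleMap c R θ, y)) y₀ v)
      (volume.restrict (uIoc 0 (2 * Real.pi))) := by
    intro v
    obtain ⟨ε, hε, hεv⟩ : ∃ ε : ℝ, 0 < ε ∧ ε * ‖v‖ < r :=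
      ⟨r / (‖v‖ + 1), by positivity, by
        rw [div_mul_eq_mul_div, div_lt_iff₀ (by positivity)]; nlinarith [norm_nonneg v]⟩
    let t : ℕ → ℂ := fun n => ((ε / (n + 1) : ℝ) : ℂ)
    have ht0 : ∀ n, t n ≠ 0 := fun n => by
      simp only [t, ne_eq, Complex.ofReal_eq_zero]; positivity
    have ht : Tendsto t atTop (𝓝[≠] 0) := by
      refine tendsto_nhdsWithin_iff.2 ⟨?_, Eventually.of_forall ht0⟩
      have h : Tendsto (fun n : ℕ => ε * (1 / ((n : ℝ) + 1))) atTop (𝓝 (ε * 0)) :=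
        tendsto_one_div_add_atTop_nhds_zero_nat.const_mul ε
      simp only [mul_one_div, mul_zero] at h
      exact (Complex.continuous_ofReal.tendsto' 0 0 Complex.ofReal_zero).comp h
    have hball : ∀ n, y₀ + t n • v ∈ ball y₀ r := by
      intro n
      rw [mem_ball, dist_eq_norm, add_sub_cancel_left, norm_smul]
      refine lt_of_le_of_lt (mul_le_mul_of_nonneg_right ?_ (norm_nonneg v)) hεv
      simp only [t, Complex.norm_real, Real.norm_eq_abs]
      rw [abs_of_pos (by positivity)]
      exact div_le_self hε.le (by linarith [Nat.cast_nonneg (α := ℝ) n])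
    refine aestronglyMeasurable_of_tendsto_ae atTop
      (f := fun n (θ : ℝ) => (t n)⁻¹ • (H (circleMap c R θ, y₀ + t n • v) - H (circleMap c R θ, y₀)))
      (fun n => ?_) (Eventually.of_forall fun θ => ?_)
    · have h := ((hcont _ (hball n)).sub (hcont _ hy₀)).const_smul (t n)⁻¹
      exact Continuous.aestronglyMeasurable h
    · have := ((hdiff _ (hmem θ) y₀ hy₀).hasFDerivAt.hasLineDerivAt v).tendsto_slope_zero
      exact this.comp ht
  have hmain := intervalIntegral.hasFDerivAt_integral_of_dominated_of_fderiv_le (𝕜 := ℂ)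
    (μ := volume) (a := 0) (b := 2 * Real.pi) (s := ball y₀ (r / 2)) (x₀ := y₀)
    (F := fun y θ => deriv (circleMap c R) θ • H (circleMap c R θ, y))
    (F' := fun y θ => deriv (circleMap c R) θ • fderiv ℂ (fun y => H (circleMap c R θ, y)) y)
    (bound := fun θ => |R| * ((2 * C) / (r / 2))) (ball_mem_nhds _ (half_pos hr)) ?_ ?_ ?_ ?_ ?_ ?_
  · exact hmain.differentiableAt
  · filter_upwards [ball_mem_nhds y₀ hr] with y hy
    exact (hdc.smul (hcont y hy)).aestronglyMeasurable
  · exact (hdc.smul (hcont y₀ hy₀)).intervalIntegrable _ _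
  · exact hdc.aestronglyMeasurable.smul (aestronglyMeasurable_clm_of_apply hfd)
  · refine Eventually.of_forall fun θ _ y hy => ?_
    rw [norm_smul]
    refine mul_le_mul ?_ (hder _ (hmem θ) y hy) (norm_nonneg _) (abs_nonneg _)
    simp [deriv_circleMap]
  · exact intervalIntegrable_const
  · refine Eventually.of_forall fun θ _ y hy => ?_
    have hy' : y ∈ ball y₀ r := ball_subset_ball (by linarith) hy
    have h := (hdiff _ (hmem θ) y hy').hasFDerivAt.const_smul (deriv (circleMap c R) θ)
    exact h

end ParametricCircleIntegral

/-! ### Division by a polynomial with holomorphic coefficients -/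

section WeierstrassDivision

open Metric Set Polynomial

/-- Two functions that are continuous at `t` and agree near `t`, except possibly at `t`, agree
at `t`. -/
theorem eq_of_eventuallyEq_nhdsNE {f g : ℂ → ℂ} {t : ℂ} (hf : ContinuousAt f t)
    (hg : ContinuousAt g t) (h : f =ᶠ[𝓝[≠] t] g) : f t = g t :=
  tendsto_nhds_unique_of_eventuallyEq (hf.tendsto.mono_left nhdsWithin_le_nhds)
    (hg.tendsto.mono_left nhdsWithin_le_nhds) h

/-- If a polynomial `G` is a continuous multiple of a monic polynomial `P` on an open set that
contains all roots of `P`, then `P` divides `G`. -/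
theorem Polynomial.dvd_of_eval_eq_mul {U : Set ℂ} (hU : IsOpen U) {q : ℂ → ℂ}
    (hq : ContinuousOn q U) {P G : ℂ[X]} (hP : P.Monic) (hroot : ∀ t, P.eval t = 0 → t ∈ U)
    (h : ∀ t ∈ U, G.eval t = P.eval t * q t) : P ∣ G := by
  induction hn : P.natDegree generalizing P G with
  | zero => rw [hP.natDegree_eq_zero.1 hn]; exact one_dvd _
  | succ n ih =>
    -- Strip one root `r` off both polynomials. Cancelling the factor `t - r` is legitimate for `t ≠
    -- r`, and continuity recovers the identity at `r`.
    obtain ⟨r, hr⟩ := IsAlgClosed.exists_root P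
      (by rw [degree_eq_natDegree hP.ne_zero, hn]; exact_mod_cast n.succ_ne_zero)
    obtain ⟨P', rfl⟩ := dvd_iff_isRoot.2 hr
    have hrU : r ∈ U := hroot r hr
    have hr' : G.IsRoot r := by rw [IsRoot, h r hrU, hr, zero_mul]
    obtain ⟨G', rfl⟩ := dvd_iff_isRoot.2 hr'
    have hP' : P'.Monic := (monic_X_sub_C r).of_mul_monic_left hP
    refine mul_dvd_mul_left _ (ih hP' (fun t ht => hroot t (by simp [ht])) ?_ ?_)
    · have hne : ∀ t ∈ U, t ≠ r → G'.eval t = P'.eval t * q t := by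
        intro t ht htr
        have := h t ht
        simp only [eval_mul, eval_sub, eval_X, eval_C, mul_assoc] at this
        exact mul_left_cancel₀ (sub_ne_zero.2 htr) this
      intro t ht
      by_cases htr : t = r
      · subst htr
        refine eq_of_eventuallyEq_nhdsNE G'.continuous.continuousAt
          (P'.continuous.continuousAt.mul (hq.continuousAt (hU.mem_nhds ht))) ?_
        filter_upwards [self_mem_nhdsWithin, mem_nhdsWithin_of_mem_nhds (hU.mem_nhds ht)]
          with s hs hsU using hne s hsU hs
      · exact hne t ht htr
    · rw [(monic_X_sub_C r).natDegree_mul hP', natDegree_X_sub_C] at hn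
      omega

/-- Uniqueness of the division by a monic polynomial in the ring of continuous functions on an
open set that contains all its roots. -/
theorem Polynomial.eq_zero_of_eval_eq_mul {U : Set ℂ} (hU : IsOpen U) {q : ℂ → ℂ}
    (hq : ContinuousOn q U) {P G : ℂ[X]} (hP : P.Monic) (hroot : ∀ t, P.eval t = 0 → t ∈ U)
    (h : ∀ t ∈ U, G.eval t = P.eval t * q t) (hdeg : G.degree < P.degree) :
    G = 0 ∧ ∀ t ∈ U, q t = 0 := by
  have hG : G = 0 := eq_zero_of_dvd_of_degree_lt (dvd_of_eval_eq_mul hU hq hP hroot h) hdeg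
  refine ⟨hG, fun t ht => ?_⟩
  -- Once `G = 0`, the quotient vanishes off the finitely many roots of `P`, hence everywhere by
  -- continuity.
  have hfin : ({s | P.eval s = 0} \ {t}).Finite := by
    refine (P.roots.toFinset.finite_toSet.subset ?_).sdiff
    intro s hs
    simpa [hP.ne_zero] using hs
  refine eq_of_eventuallyEq_nhdsNE (g := fun _ => 0) (hq.continuousAt (hU.mem_nhds ht))
    continuousAt_const ?_
  filter_upwards [self_mem_nhdsWithin, mem_nhdsWithin_of_mem_nhds (hU.mem_nhds ht),
    mem_nhdsWithin_of_mem_nhds (hfin.isClosed.isOpen_compl.mem_nhds fun hh => hh.2 rfl)]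
    with s hst hsU hs
  have h0 := h s hsU
  rw [hG, eval_zero, eq_comm] at h0
  exact (mul_eq_zero.1 h0).resolve_left fun hh => hs ⟨hh, hst⟩

variable {F : Type*} [NormedAddCommGroup F]

/-- The roots of a monic polynomial whose other coefficients tend to zero tend to zero. -/
theorem eventually_sum_mul_pow_ne_zero {m : ℕ} {a : ℕ → F → ℂ} {y₀ : F}
    (ha : ∀ l, ContinuousAt (a l) y₀) (h0 : ∀ l < m, a l y₀ = 0) (h1 : a m = 1)
    {ε : ℝ} (hε : 0 < ε) :
    ∀ᶠ y in 𝓝 y₀, ∀ t : ℂ, ε ≤ ‖t‖ → ∑ l ∈ Finset.range (m + 1), a l y * t ^ l ≠ 0 := by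
  -- With this threshold each lower term is at most `‖t‖ ^ m / (m + 1)` when `ε ≤ ‖t‖`. The `m` of
  -- them together stay strictly below the leading term.
  have hsmall : ∀ᶠ y in 𝓝 y₀, ∀ l ∈ Finset.range m, ‖a l y‖ < ε ^ (m - l) / (m + 1) := by
    refine (Finset.range m).eventually_all.2 fun l hl => ?_
    have : ContinuousAt (fun y => ‖a l y‖) y₀ := (ha l).norm
    refine this.eventually (gt_mem_nhds ?_)
    simp only [h0 l (Finset.mem_range.1 hl), norm_zero]
    positivity
  filter_upwards [hsmall] with y hy t ht hzero
  have htpos : 0 < ‖t‖ := hε.trans_le ht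
  rw [Finset.sum_range_succ, h1, Pi.one_apply, one_mul] at hzero
  have h2 : ‖∑ l ∈ Finset.range m, a l y * t ^ l‖ = ‖t‖ ^ m := by
    rw [eq_neg_of_add_eq_zero_left hzero, norm_neg, norm_pow]
  have h3 : ‖∑ l ∈ Finset.range m, a l y * t ^ l‖ ≤ ∑ l ∈ Finset.range m, ‖t‖ ^ m / (m + 1) := by
    refine norm_sum_le_of_le _ fun l hl => ?_
    have hlm : m - l + l = m := Nat.sub_add_cancel (Finset.mem_range.1 hl).le
    calc ‖a l y * t ^ l‖ = ‖a l y‖ * ‖t‖ ^ l := by rw [norm_mul, norm_pow]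
      _ ≤ ‖t‖ ^ (m - l) / (m + 1) * ‖t‖ ^ l := by
          gcongr
          exact (hy l hl).le.trans (by gcongr)
      _ = ‖t‖ ^ m / (m + 1) := by rw [div_mul_eq_mul_div, ← pow_add, hlm]
  rw [h2, Finset.sum_const, Finset.card_range, nsmul_eq_mul, ← mul_div_assoc,
    le_div_iff₀ (by positivity)] at h3
  nlinarith [pow_pos htpos m]

/-- Uniqueness of Weierstrass division. -/
theorem eventually_eq_zero_of_weierstrass_division {q : ℂ × F → ℂ} {y₀ : F}
    (hq : ∀ᶠ u in 𝓝 ((0 : ℂ), y₀), ContinuousAt q u) {m : ℕ} {a r : ℕ → F → ℂ}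
    (ha : ∀ l, ContinuousAt (a l) y₀) (h0 : ∀ l < m, a l y₀ = 0) (h1 : a m = 1)
    (h : ∀ᶠ u in 𝓝 ((0 : ℂ), y₀), (∑ l ∈ Finset.range (m + 1), a l u.2 * u.1 ^ l) * q u =
      ∑ l ∈ Finset.range m, r l u.2 * u.1 ^ l) :
    (∀ᶠ u in 𝓝 ((0 : ℂ), y₀), q u = 0) ∧ ∀ᶠ y in 𝓝 y₀, ∀ l < m, r l y = 0 := by
  have h' := hq.and h
  rw [nhds_prod_eq] at h'
  obtain ⟨p₁, hp₁, p₂, hp₂, hp⟩ := eventually_prod_iff.1 h'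
  obtain ⟨ε, hε, hball⟩ := Metric.eventually_nhds_iff_ball.1 hp₁
  -- For fixed `y` near `y₀` all roots of the divisor lie in the disc where the identity holds, so
  -- uniqueness in one variable applies.
  have key : ∀ᶠ y in 𝓝 y₀, (∀ t ∈ ball (0 : ℂ) ε, q (t, y) = 0) ∧ ∀ l < m, r l y = 0 := by
    filter_upwards [hp₂, eventually_sum_mul_pow_ne_zero ha h0 h1 hε] with y hy hroot
    let P : ℂ[X] := X ^ m + ∑ l ∈ Finset.range m, C (a l y) * X ^ l
    let G : ℂ[X] := ∑ l ∈ Finset.range m, C (r l y) * X ^ l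
    have hlow : ∀ c : ℕ → ℂ, (∑ l ∈ Finset.range m, C (c l) * X ^ l : ℂ[X]).degree < m := by
      intro c
      refine (degree_sum_le _ _).trans_lt ((Finset.sup_lt_iff (WithBot.bot_lt_coe m)).2 ?_)
      intro l hl
      exact (degree_C_mul_X_pow_le _ _).trans_lt (WithBot.coe_lt_coe.2 (Finset.mem_range.1 hl))
    have hP : P.Monic := monic_X_pow_add (hlow fun l => a l y)
    have hPdeg : P.degree = m := by
      simpa using degree_add_eq_left_of_degree_lt
        (p := (X : ℂ[X]) ^ m) (by simpa using hlow fun l => a l y)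
    have hPe : ∀ t, P.eval t = ∑ l ∈ Finset.range (m + 1), a l y * t ^ l := by
      intro t
      rw [Finset.sum_range_succ, h1]
      simp [P, eval_finsetSum, add_comm]
    have hGe : ∀ t, G.eval t = ∑ l ∈ Finset.range m, r l y * t ^ l := by
      intro t
      simp [G, eval_finsetSum]
    have hcont : ContinuousOn (fun t => q (t, y)) (ball 0 ε) := by
      intro t ht
      have hc : ContinuousAt q (t, y) := (hp (hball t ht) hy).1
      exact (ContinuousAt.comp (f := fun t => (t, y)) hc (by fun_prop)).continuousWithinAt
    have hroot' : ∀ t, P.eval t = 0 → t ∈ ball (0 : ℂ) ε := by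
      intro t ht
      rw [hPe] at ht
      by_contra hh
      rw [mem_ball_zero_iff, not_lt] at hh
      exact hroot t hh ht
    have heq : ∀ t ∈ ball (0 : ℂ) ε, G.eval t = P.eval t * q (t, y) := by
      intro t ht
      rw [hPe, hGe]
      exact (hp (hball t ht) hy).2.symm
    obtain ⟨hG, hq0⟩ := Polynomial.eq_zero_of_eval_eq_mul isOpen_ball hcont hP hroot' heq
      (by rw [hPdeg]; exact hlow _)
    refine ⟨hq0, fun l hl => ?_⟩
    have := congrArg (fun p : ℂ[X] => p.coeff l) hG
    simpa [G, finsetSum_coeff, coeff_C_mul, coeff_X_pow, hl] using this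
  refine ⟨?_, key.mono fun y hy => hy.2⟩
  rw [nhds_prod_eq]
  have hb : ∀ᶠ t in 𝓝 (0 : ℂ), t ∈ ball (0 : ℂ) ε := ball_mem_nhds 0 hε
  filter_upwards [hb.prod_mk key] with u hu using hu.2.1 u.1 hu.1

/-- **Weierstrass division**, for a divisor that is a polynomial in the first variable. -/
theorem exists_weierstrass_division [NormedSpace ℂ F] [FiniteDimensional ℂ F] {g : ℂ × F → ℂ} {y₀ : F}
    (hg : ∀ᶠ u in 𝓝 ((0 : ℂ), y₀), DifferentiableAt ℂ g u) {m : ℕ} {a : ℕ → F → ℂ}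
    (ha : ∀ l, ∀ᶠ y in 𝓝 y₀, DifferentiableAt ℂ (a l) y) (h0 : ∀ l < m, a l y₀ = 0)
    (h1 : a m = 1) :
    ∃ (q : ℂ × F → ℂ) (I : ℕ → F → ℂ), (∀ᶠ u in 𝓝 ((0 : ℂ), y₀), DifferentiableAt ℂ q u) ∧
      (∀ k, ∀ᶠ y in 𝓝 y₀, DifferentiableAt ℂ (I k) y) ∧
      ∀ᶠ u in 𝓝 ((0 : ℂ), y₀), g u = (∑ l ∈ Finset.range (m + 1), a l u.2 * u.1 ^ l) * q u +
        ∑ l ∈ Finset.range (m + 1), a l u.2 * ∑ j ∈ Finset.range l, u.1 ^ j * I (l - 1 - j) u.2 := by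
  have hg' := hg
  rw [nhds_prod_eq] at hg'
  obtain ⟨p₁, hp₁, p₂, hp₂, hp⟩ := eventually_prod_iff.1 hg'
  obtain ⟨ε', hε', hball⟩ := Metric.eventually_nhds_iff_ball.1 hp₁
  obtain ⟨ε, hε, hlt⟩ := exists_between hε'
  have ha' : ∀ᶠ y in 𝓝 y₀, ∀ l ∈ Finset.range (m + 1), DifferentiableAt ℂ (a l) y :=
    (Finset.range (m + 1)).eventually_all.2 fun l _ => ha l
  have hne := eventually_sum_mul_pow_ne_zero (fun l => (ha l).self_of_nhds.continuousAt) h0 h1 hε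
  obtain ⟨δ, hδ, hgood⟩ := Metric.eventually_nhds_iff_ball.1 ((hp₂.and ha').and hne)
  let P : ℂ × F → ℂ := fun u => ∑ l ∈ Finset.range (m + 1), a l u.2 * u.1 ^ l
  have hev : ∀ t ∈ ball (0 : ℂ) ε', ∀ y ∈ ball y₀ δ, ∀ᶠ u in 𝓝 (t, y),
      u.1 ∈ ball (0 : ℂ) ε' ∧ u.2 ∈ ball y₀ δ := fun t ht y hy =>
    (isOpen_ball.prod isOpen_ball).mem_nhds (Set.mk_mem_prod ht hy)
  have hgd : ∀ t ∈ ball (0 : ℂ) ε', ∀ y ∈ ball y₀ δ, DifferentiableAt ℂ g (t, y) :=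
    fun t ht y hy => hp (hball t ht) (hgood y hy).1.1
  have hPd : ∀ t : ℂ, ∀ y ∈ ball y₀ δ, DifferentiableAt ℂ P (t, y) := by
    intro t y hy
    refine DifferentiableAt.fun_sum fun l hl => DifferentiableAt.mul ?_ (by fun_prop)
    exact DifferentiableAt.comp (t, y) (g := a l) (f := Prod.snd)
      ((hgood y hy).1.2 l hl) differentiableAt_snd
  have hsph : ∀ s ∈ sphere (0 : ℂ) ε, s ∈ ball (0 : ℂ) ε' ∧ ε ≤ ‖s‖ := by
    intro s hs
    rw [mem_sphere_zero_iff_norm] at hs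
    exact ⟨by rw [mem_ball_zero_iff, hs]; exact hlt, hs.ge⟩
  have hQ : ∀ s ∈ sphere (0 : ℂ) ε, ∀ y ∈ ball y₀ δ,
      ∀ᶠ u in 𝓝 (s, y), DifferentiableAt ℂ (fun u => g u / P u) u := by
    intro s hs y hy
    have hPs : P (s, y) ≠ 0 := (hgood y hy).2 s (hsph s hs).2
    filter_upwards [hev s (hsph s hs).1 y hy,
      (hPd s y hy).continuousAt.eventually_ne hPs] with u hu hu'
    simp only [div_eq_mul_inv]
    exact (hgd u.1 hu.1 u.2 hu.2).mul ((hPd u.1 u.2 hu.2).inv hu')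
  have hQc : ∀ y ∈ ball y₀ δ, ContinuousOn (fun s => g (s, y) / P (s, y)) (sphere 0 ε) := by
    intro y hy s hs
    have hc : ContinuousAt (fun u => g u / P u) (s, y) :=
      (hQ s hs y hy).self_of_nhds.continuousAt
    exact (ContinuousAt.comp (f := fun s => (s, y)) hc (by fun_prop)).continuousWithinAt
  -- The moments of `g / P` along the circle make up the remainder; its Cauchy transform `q` is the
  -- quotient.
  let I : ℕ → F → ℂ := fun k y =>
    (2 * Real.pi * Complex.I : ℂ)⁻¹ * ∮ s in C(0, ε), s ^ k * (g (s, y) / P (s, y))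
  let q : ℂ × F → ℂ := fun u =>
    (2 * Real.pi * Complex.I : ℂ)⁻¹ * ∮ s in C(0, ε), (s - u.1)⁻¹ * (g (s, u.2) / P (s, u.2))
  have hb : ∀ᶠ y in 𝓝 y₀, y ∈ ball y₀ δ := ball_mem_nhds _ hδ
  have hbb : ∀ᶠ u in 𝓝 ((0 : ℂ), y₀), u.1 ∈ ball (0 : ℂ) ε ∧ u.2 ∈ ball y₀ δ :=
    (isOpen_ball.prod isOpen_ball).mem_nhds
      (Set.mk_mem_prod (mem_ball_self hε) (mem_ball_self hδ))
  refine ⟨q, I, ?_, fun k => ?_, ?_⟩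
  · filter_upwards [hbb] with u hu
    refine DifferentiableAt.const_mul (differentiableAt_circleIntegral
      (H := fun v : ℂ × (ℂ × F) => (v.1 - v.2.1)⁻¹ * (g (v.1, v.2.2) / P (v.1, v.2.2)))
      fun s hs => ?_) _
    rw [abs_of_pos hε] at hs
    have hsu : s - u.1 ≠ 0 := by
      rintro h
      rw [sub_eq_zero] at h
      have h2 := mem_ball_zero_iff.1 hu.1
      rw [← h, mem_sphere_zero_iff_norm.1 hs] at h2
      exact lt_irrefl _ h2
    have hc : ContinuousAt (fun v : ℂ × (ℂ × F) => (v.1, v.2.2)) (s, u) := by fun_prop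
    have hc' : ContinuousAt (fun v : ℂ × (ℂ × F) => v.1 - v.2.1) (s, u) := by fun_prop
    filter_upwards [hc.eventually (hQ s hs u.2 hu.2), hc'.eventually_ne hsu] with v hv hv'
    refine DifferentiableAt.mul (DifferentiableAt.inv (by fun_prop) hv') ?_
    exact DifferentiableAt.comp v (f := fun v : ℂ × (ℂ × F) => (v.1, v.2.2)) hv (by fun_prop)
  · filter_upwards [hb] with y hy
    refine DifferentiableAt.const_mul (differentiableAt_circleIntegral
      (H := fun v : ℂ × F => v.1 ^ k * (g v / P v)) fun s hs => ?_) _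
    rw [abs_of_pos hε] at hs
    filter_upwards [hQ s hs y hy] with v hv
    exact DifferentiableAt.mul (by fun_prop) hv
  · filter_upwards [hbb] with u hu
    obtain ⟨t, y⟩ := u
    obtain ⟨ht, hy⟩ := hu
    have hst : ∀ s ∈ sphere (0 : ℂ) ε, s - t ≠ 0 := by
      rintro s hs h
      rw [sub_eq_zero] at h
      have h2 := mem_ball_zero_iff.1 ht
      rw [← h, mem_sphere_zero_iff_norm.1 hs] at h2
      exact lt_irrefl _ h2
    have hcauchy := DifferentiableOn.circleIntegral_sub_inv_smul (R := ε) (c := 0) (w := t)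
      (f := fun s => g (s, y)) (fun s hs => by
        have hs' : s ∈ ball (0 : ℂ) ε' := closedBall_subset_ball hlt hs
        exact (DifferentiableAt.comp s (f := fun s => (s, y)) (hgd s hs' y hy)
          (by fun_prop)).differentiableWithinAt) ht
    have hint1 : CircleIntegrable (fun s => (s - t)⁻¹ * (g (s, y) / P (s, y))) 0 ε := by
      refine ContinuousOn.circleIntegrable hε.le (ContinuousOn.mul ?_ (hQc y hy))
      exact ContinuousOn.inv₀ (by fun_prop) hst
    have hint2 : ∀ k, CircleIntegrable (fun s => s ^ k * (g (s, y) / P (s, y))) 0 ε := fun k =>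
      ContinuousOn.circleIntegrable hε.le (ContinuousOn.mul (by fun_prop) (hQc y hy))
    -- In Cauchy's formula for `g`, write `g = P * (g / P)` and split `P(s) = P(t) + (P(s) - P(t))`.
    -- The first part yields `P * q`. In the second, `s - t` divides `P(s) - P(t)`, leaving a
    -- polynomial in `t` of degree below `m`. For `l = 0` the inner sum is empty, so the truncated
    -- `l - 1` does no harm.
    have hpoint : EqOn (fun s => (s - t)⁻¹ • g (s, y))
        (fun s => P (t, y) * ((s - t)⁻¹ * (g (s, y) / P (s, y))) +
          ∑ l ∈ Finset.range (m + 1), ∑ j ∈ Finset.range l,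
            (a l y * t ^ j) * (s ^ (l - 1 - j) * (g (s, y) / P (s, y)))) (sphere 0 ε) := by
      intro s hs
      have hPs : P (s, y) ≠ 0 := (hgood y hy).2 s (hsph s hs).2
      have hgeom : P (s, y) - P (t, y) = (s - t) * ∑ l ∈ Finset.range (m + 1),
          ∑ j ∈ Finset.range l, (a l y * t ^ j) * s ^ (l - 1 - j) := by
        simp only [P, ← Finset.sum_sub_distrib, Finset.mul_sum]
        refine Finset.sum_congr rfl fun l _ => ?_
        rw [← mul_sub, ← neg_sub, ← geom_sum₂_mul, Finset.sum_mul, ← Finset.sum_neg_distrib,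
          Finset.mul_sum]
        exact Finset.sum_congr rfl fun j _ => by ring
      simp only [← mul_assoc, ← Finset.sum_mul]
      simp only [smul_eq_mul]
      have hs' := hst s hs
      have hgeom' : ∑ l ∈ Finset.range (m + 1),
          ∑ j ∈ Finset.range l, (a l y * t ^ j) * s ^ (l - 1 - j) =
          (P (s, y) - P (t, y)) / (s - t) := by rw [hgeom]; field_simp
      rw [hgeom']
      field_simp
      ring
    have hint3 : ∀ l j, CircleIntegrable
        (fun s => (a l y * t ^ j) * (s ^ (l - 1 - j) * (g (s, y) / P (s, y)))) 0 ε := fun l j =>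
      (hint2 (l - 1 - j)).const_smul
    have hint4 : ∀ l, CircleIntegrable (fun s => ∑ j ∈ Finset.range l,
        (a l y * t ^ j) * (s ^ (l - 1 - j) * (g (s, y) / P (s, y)))) 0 ε := fun l =>
      CircleIntegrable.fun_sum _ fun j _ => hint3 l j
    have hint5 : CircleIntegrable (fun s => P (t, y) * ((s - t)⁻¹ * (g (s, y) / P (s, y)))) 0 ε :=
      hint1.const_smul
    rw [circleIntegral.integral_congr hε.le hpoint,
      circleIntegral.integral_add hint5 (CircleIntegrable.fun_sum _ fun l _ => hint4 l),
      circleIntegral.integral_const_mul,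
      circleIntegral.integral_fun_sum fun l _ => hint4 l] at hcauchy
    simp only [fun l => circleIntegral.integral_fun_sum (s := Finset.range l) fun j _ => hint3 l j,
      circleIntegral.integral_const_mul] at hcauchy
    rw [eq_comm, smul_eq_mul, ← eq_inv_mul_iff_mul_eq₀ Complex.two_pi_I_ne_zero] at hcauchy
    rw [hcauchy, mul_add, Finset.mul_sum]
    congr 1
    · simp only [q, P]
      ring
    · refine Finset.sum_congr rfl fun l _ => ?_
      rw [Finset.mul_sum, Finset.mul_sum]
      refine Finset.sum_congr rfl fun j _ => ?_
      simp only [I]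
      ring

end WeierstrassDivision

/-! ### A criterion for the exactness of Koszul complexes -/

section KoszulExact

namespace Module.Basis

variable {A M ι : Type*} [CommRing A] [AddCommGroup M] [Module A M] [Fintype ι]
  (B : Module.Basis ι A M)

/-- The additive map that applies `f` to all coordinates with respect to the basis `B`. -/
noncomputable def coordMap (f : A →+ A) : M →+ M where
  toFun u := ∑ s, f (B.repr u s) • B s
  map_zero' := by simp
  map_add' u v := by simp [add_smul, Finset.sum_add_distrib]

theorem repr_coordMap (f : A →+ A) (u : M) (s : ι) : B.repr (B.coordMap f u) s = f (B.repr u s) := by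
  classical
  simp [coordMap, Finsupp.single_apply]

theorem coordMap_smul_eq {f g : A →+ A} {a : A} (h : ∀ c, f (a * c) = g c) (u : M) :
    B.coordMap f (a • u) = B.coordMap g u :=
  B.ext_elem fun s => by simp [repr_coordMap, h]

theorem smul_coordMap_eq {f g : A →+ A} {a : A} (h : ∀ c, a * f c = g c) (u : M) :
    a • B.coordMap f u = B.coordMap g u :=
  B.ext_elem fun s => by simp [repr_coordMap, h]

theorem coordMap_id (u : M) : B.coordMap (AddMonoidHom.id A) u = u :=
  B.ext_elem fun s => by simp [repr_coordMap]

theorem coordMap_sub (f g : A →+ A) (u : M) :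
    B.coordMap (f - g) u = B.coordMap f u - B.coordMap g u :=
  B.ext_elem fun s => by simp [repr_coordMap]

/-- Such a `u` has integer coordinates, and additive maps commute with multiplication by integers.
-/
theorem coordMap_smul_of_mem_closure (f : A →+ A) (a : A) {u : M}
    (hu : u ∈ AddSubgroup.closure (Set.range B)) : B.coordMap f (a • u) = f a • u := by
  classical
  induction hu using AddSubgroup.closure_induction with
  | mem u hu =>
    obtain ⟨s, rfl⟩ := hu
    refine B.ext_elem fun t => ?_
    by_cases h : s = t <;> simp [repr_coordMap, h]
  | zero => simp
  | add u v _ _ hu hv => rw [smul_add, map_add, hu, hv, smul_add]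
  | neg u _ hu => rw [smul_neg, map_neg, hu, smul_neg]

/-- Applying an additive map to the coordinates commutes with linear maps given by integral
matrices. -/
theorem coordMap_comm (f : A →+ A) (L : M →ₗ[A] M)
    (hL : ∀ s, L (B s) ∈ AddSubgroup.closure (Set.range B)) (u : M) :
    B.coordMap f (L u) = L (B.coordMap f u) := by
  have h : B.coordMap f u = ∑ s, f (B.repr u s) • B s := rfl
  rw [h, map_sum]
  conv_lhs => rw [← B.sum_repr u, map_sum, map_sum]
  refine Finset.sum_congr rfl fun s _ => ?_
  rw [L.map_smul, L.map_smul, B.coordMap_smul_of_mem_closure f _ (hL s)]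

end Module.Basis

variable {A : Type*} [CommRing A] {p : ℕ}

/-- The basis of the exterior algebra of `A^p` consisting of the products of basis vectors. -/
noncomputable abbrev extBasis (A : Type*) [CommRing A] (p : ℕ) :
    Module.Basis (Finset (Fin p)) A (ExteriorAlgebra A (Fin p → A)) :=
  (Pi.basisFun A (Fin p)).ExteriorAlgebra

/-- Exterior multiplication by the `i`-th basis vector. -/
noncomputable def wedge (i : Fin p) :
    ExteriorAlgebra A (Fin p → A) →ₗ[A] ExteriorAlgebra A (Fin p → A) :=
  LinearMap.mulLeft A (ExteriorAlgebra.ι A (Pi.single i 1))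

/-- Contraction with the `i`-th coordinate function. -/
noncomputable def contr (i : Fin p) :
    ExteriorAlgebra A (Fin p → A) →ₗ[A] ExteriorAlgebra A (Fin p → A) :=
  CliffordAlgebra.contractLeft (Q := (0 : QuadraticForm A (Fin p → A))) (LinearMap.proj i)

/-- The Koszul differential on the whole exterior algebra. -/
noncomputable def koszulContr (x : Fin p → A) :
    ExteriorAlgebra A (Fin p → A) →ₗ[A] ExteriorAlgebra A (Fin p → A) :=
  CliffordAlgebra.contractLeft (Q := (0 : QuadraticForm A (Fin p → A)))
    (∑ i, x i • LinearMap.proj i)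

theorem koszulContr_eq (x : Fin p → A) (u : ExteriorAlgebra A (Fin p → A)) :
    koszulContr x u = ∑ i, x i • contr i u := by
  simp [koszulContr, contr, map_sum, LinearMap.sum_apply]

theorem koszulContr_koszulContr (x : Fin p → A) (u : ExteriorAlgebra A (Fin p → A)) :
    koszulContr x (koszulContr x u) = 0 :=
  CliffordAlgebra.contractLeft_contractLeft _ _

theorem koszulContr_wedge (x : Fin p → A) (i : Fin p) (u : ExteriorAlgebra A (Fin p → A)) :
    koszulContr x (wedge i u) = x i • u - wedge i (koszulContr x u) := by
  have h := CliffordAlgebra.contractLeft_ι_mul (Q := (0 : QuadraticForm A (Fin p → A)))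
    (∑ j, x j • LinearMap.proj j) (Pi.single i (1 : A)) u
  refine h.trans ?_
  congr 2
  simp [LinearMap.sum_apply, Pi.single_apply]

theorem contr_wedge (j i : Fin p) (u : ExteriorAlgebra A (Fin p → A)) :
    contr j (wedge i u) = (if i = j then u else 0) - wedge i (contr j u) := by
  have h := CliffordAlgebra.contractLeft_ι_mul (Q := (0 : QuadraticForm A (Fin p → A)))
    (LinearMap.proj j) (Pi.single i (1 : A)) u
  refine h.trans ?_
  congr 1
  by_cases hij : i = j <;> simp [hij]

theorem wedge_wedge_self (i : Fin p) (u : ExteriorAlgebra A (Fin p → A)) :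
    wedge i (wedge i u) = 0 := by
  simp [wedge, ← mul_assoc]

theorem wedge_wedge_comm (i j : Fin p) (u : ExteriorAlgebra A (Fin p → A)) :
    wedge i (wedge j u) = -wedge j (wedge i u) := by
  have h := ExteriorAlgebra.ι_add_mul_swap (R := A) (M := Fin p → A) (Pi.single i 1) (Pi.single j 1)
  simp only [wedge, LinearMap.mulLeft_apply, ← mul_assoc]
  rw [eq_neg_iff_add_eq_zero, ← add_mul, h, zero_mul]

theorem extBasis_empty : extBasis A p ∅ = 1 := by
  rw [ExteriorAlgebra.basis_apply_ofCard (n := 0) _ Finset.card_empty]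
  simp [ExteriorAlgebra.ιMulti_family]

theorem extBasis_singleton (i : Fin p) :
    extBasis A p {i} = ExteriorAlgebra.ι A (Pi.single i 1) := by
  rw [ExteriorAlgebra.basis_apply_ofCard (n := 1) _ (Finset.card_singleton i)]
  have h : ∀ k, Set.powersetCard.ofFinEmbEquiv.symm
      (Set.powersetCard.ofCard (Finset.card_singleton i)) k = i := by
    intro k
    rw [Set.powersetCard.ofFinEmbEquiv_symm_apply]
    exact Finset.mem_singleton.1 (Finset.orderEmbOfFin_mem _ _ k)
  simp [ExteriorAlgebra.ιMulti_family, h]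

/-- The integral span of the basis vectors of the exterior algebra is stable under exterior
multiplication by basis vectors. -/
theorem wedge_mem_closure (i : Fin p) {u : ExteriorAlgebra A (Fin p → A)}
    (hu : u ∈ AddSubgroup.closure (Set.range (extBasis A p))) :
    wedge i u ∈ AddSubgroup.closure (Set.range (extBasis A p)) := by
  induction hu using AddSubgroup.closure_induction with
  | mem u hu =>
    obtain ⟨t, rfl⟩ := hu
    change ExteriorAlgebra.ι A (Pi.single i 1) * _ ∈ _
    rw [← extBasis_singleton]
    let s' : Set.powersetCard (Fin p) 1 := ⟨{i}, by simp⟩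
    let t' : Set.powersetCard (Fin p) t.card := ⟨t, by simp⟩
    by_cases h : Disjoint s'.val t'.val
    · have := ExteriorAlgebra.basis_mul_of_disjoint (Pi.basisFun A (Fin p)) s' t' h
      refine this ▸ ?_
      rw [Units.smul_def]
      exact AddSubgroup.zsmul_mem _ (AddSubgroup.subset_closure (Set.mem_range_self _)) _
    · have := ExteriorAlgebra.basis_mul_of_not_disjoint (Pi.basisFun A (Fin p)) s' t' h
      exact this ▸ zero_mem _
  | zero => simp
  | add u v _ _ hu hv => rw [map_add]; exact add_mem hu hv
  | neg u _ hu => rw [map_neg]; exact neg_mem hu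

/-- A basis element is a product of vectors `e_j`, so the Leibniz rule and induction on the number
of factors apply. With `wedge_mem_closure` this shows that contraction and exterior multiplication
have integer matrices, hence commute with coordinatewise additive maps. -/
theorem contr_extBasis_mem_closure (i : Fin p) (s : Finset (Fin p)) :
    contr i (extBasis A p s) ∈ AddSubgroup.closure (Set.range (extBasis A p)) := by
  have key : ∀ l : List (Fin p),
      (l.map fun j => ExteriorAlgebra.ι A (Pi.single j (1 : A) : Fin p → A)).prod ∈
        AddSubgroup.closure (Set.range (extBasis A p)) ∧
      contr i (l.map fun j => ExteriorAlgebra.ι A (Pi.single j (1 : A) : Fin p → A)).prod ∈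
        AddSubgroup.closure (Set.range (extBasis A p)) := by
    intro l
    induction l with
    | nil =>
      refine ⟨?_, ?_⟩
      · exact AddSubgroup.subset_closure ⟨∅, by simp [extBasis_empty]⟩
      · have : contr i (1 : ExteriorAlgebra A (Fin p → A)) = 0 :=
          CliffordAlgebra.contractLeft_one _ _
        simp [this]
    | cons j l ih =>
      rw [List.map_cons, List.prod_cons]
      refine ⟨wedge_mem_closure j ih.1, ?_⟩
      have := contr_wedge i j
        (l.map fun j => ExteriorAlgebra.ι A (Pi.single j (1 : A) : Fin p → A)).prod
      refine this ▸ sub_mem ?_ (wedge_mem_closure j ih.2)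
      split_ifs
      exacts [ih.1, zero_mem _]
  have hs : ∃ l : List (Fin p), extBasis A p s =
      (l.map fun j => ExteriorAlgebra.ι A (Pi.single j (1 : A) : Fin p → A)).prod := by
    rw [ExteriorAlgebra.basis_apply_ofCard (n := s.card) _ rfl, ExteriorAlgebra.ιMulti_family,
      ExteriorAlgebra.ιMulti_apply]
    refine ⟨List.ofFn (Set.powersetCard.ofFinEmbEquiv.symm
      (Set.powersetCard.ofCard (s := s) rfl)), ?_⟩
    rw [List.map_ofFn]
    congr 2
    funext k
    simp
  obtain ⟨l, hl⟩ := hs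
  rw [hl]
  exact (key l).2

theorem coordMap_wedge (f : A →+ A) (i : Fin p) (u : ExteriorAlgebra A (Fin p → A)) :
    (extBasis A p).coordMap f (wedge i u) = wedge i ((extBasis A p).coordMap f u) :=
  Module.Basis.coordMap_comm _ f _
    (fun s => wedge_mem_closure i (AddSubgroup.subset_closure ⟨s, rfl⟩)) u

theorem coordMap_contr (f : A →+ A) (i : Fin p) (u : ExteriorAlgebra A (Fin p → A)) :
    (extBasis A p).coordMap f (contr i u) = contr i ((extBasis A p).coordMap f u) :=
  Module.Basis.coordMap_comm _ f _ (contr_extBasis_mem_closure i) u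

theorem coordMap_mem_exteriorPower (f : A →+ A) {k : ℕ} {u : ExteriorAlgebra A (Fin p → A)}
    (hu : u ∈ ⋀[A]^k (Fin p → A)) : (extBasis A p).coordMap f u ∈ ⋀[A]^k (Fin p → A) := by
  have h := congrArg (Submodule.subtype _)
    (((Pi.basisFun A (Fin p)).exteriorPower k).sum_repr ⟨u, hu⟩)
  simp only [map_sum, map_smul, Submodule.subtype_apply] at h
  rw [← h, map_sum]
  refine sum_mem fun s _ => ?_
  rw [← ExteriorAlgebra.basis_eq_coe_basis, Module.Basis.coordMap_smul_of_mem_closure _ _ _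
    (AddSubgroup.subset_closure ⟨_, rfl⟩), ExteriorAlgebra.basis_eq_coe_basis]
  exact Submodule.smul_mem _ _ (Subtype.mem _)

theorem wedge_mem_exteriorPower (i : Fin p) {k : ℕ} {u : ExteriorAlgebra A (Fin p → A)}
    (hu : u ∈ ⋀[A]^k (Fin p → A)) : wedge i u ∈ ⋀[A]^(k + 1) (Fin p → A) := by
  rw [ExteriorAlgebra.exteriorPower, pow_succ']
  exact Submodule.mul_mem_mul ⟨_, rfl⟩ hu

/-- If there are additive maps `T i` on `A` that divide by `x i` and commute with multiplication by
`x j` for `j ≠ i`, then the Koszul complex of `x` is exact in positive degrees. -/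
theorem koszulDifferential_exact (x : Fin p → A) (T : Fin p → A →+ A)
    (hT : ∀ i a, T i (x i * a) = a) (hT' : ∀ i j, j ≠ i → ∀ a, T i (x j * a) = x j * T i a)
    (k : ℕ) : Function.Exact (koszulDifferential x (k + 1)) (koszulDifferential x k) := by
  let B := extBasis A p
  -- `Er i` is the remainder of division by `x i`. Since `contr i ∘ wedge i` projects onto the span
  -- of the `e_I` with `i ∉ I`, `π i` takes the remainder of exactly those components.
  let Er : Fin p → A →+ A := fun i => AddMonoidHom.id A - (AddMonoidHom.mulLeft (x i)).comp (T i)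
  let π : Fin p → AddMonoid.End (ExteriorAlgebra A (Fin p → A)) := fun i =>
    ((contr i ∘ₗ wedge i).toAddMonoidHom).comp (B.coordMap (Er i))
  have hπ : ∀ i u, π i u = contr i (wedge i (B.coordMap (Er i) u)) := fun i u => rfl
  have hmul : ∀ (f g : AddMonoid.End (ExteriorAlgebra A (Fin p → A))) u, (f * g) u = f (g u) :=
    fun _ _ _ => rfl
  have hErT : ∀ i u, B.coordMap (Er i) u = u - x i • B.coordMap (T i) u := by
    intro i u
    rw [B.smul_coordMap_eq (g := (AddMonoidHom.mulLeft (x i)).comp (T i)) fun c => rfl,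
      B.coordMap_sub, B.coordMap_id]
  -- `T i` commutes with every term `x j • contr j`, `j ≠ i`. For `j = i` the defect is the
  -- remainder: `T i (x i * a) = a = x i * T i a + Er i a`.
  have hcomm : ∀ i u, B.coordMap (T i) (koszulContr x u) =
      koszulContr x (B.coordMap (T i) u) + contr i (B.coordMap (Er i) u) := by
    intro i u
    rw [koszulContr_eq, koszulContr_eq, map_sum,
      ← Finset.add_sum_erase _ _ (Finset.mem_univ i), ← Finset.add_sum_erase _ _ (Finset.mem_univ i),
      B.coordMap_smul_eq (g := AddMonoidHom.id A) (hT i), B.coordMap_id, hErT, map_sub, map_smul]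
    have : ∀ j ∈ Finset.univ.erase i, B.coordMap (T i) (x j • contr j u) =
        x j • contr j (B.coordMap (T i) u) := by
      intro j hj
      rw [B.coordMap_smul_eq (g := (AddMonoidHom.mulLeft (x j)).comp (T i))
        (hT' i j (Finset.ne_of_mem_erase hj)), ← coordMap_contr]
      exact (B.smul_coordMap_eq (fun c => rfl) _).symm
    rw [Finset.sum_congr rfl this]
    abel
  -- On cycles, `e_i ∧ T i` is a homotopy from the identity to `π i`.
  have hhom : ∀ i u, koszulContr x u = 0 →
      koszulContr x (wedge i (B.coordMap (T i) u)) = u - π i u := by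
    intro i u hu
    have h := hcomm i u
    rw [hu, map_zero, eq_comm, add_eq_zero_iff_eq_neg] at h
    rw [koszulContr_wedge, h, hπ, contr_wedge, if_pos rfl, map_neg, hErT]
    abel
  have hπmem : ∀ i k u, u ∈ ⋀[A]^k (Fin p → A) → π i u ∈ ⋀[A]^k (Fin p → A) := fun i k u hu =>
    contractLeft_mem_exteriorPower _ _ _
      (wedge_mem_exteriorPower i (coordMap_mem_exteriorPower _ hu))
  have hπ_self : ∀ i u, π i (wedge i u) = 0 := by
    intro i u
    rw [hπ, coordMap_wedge, wedge_wedge_self, map_zero]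
  have hπ_wedge : ∀ i j u, j ≠ i → π i (wedge j u) = wedge j (π i u) := by
    intro i j u hij
    rw [hπ, hπ, coordMap_wedge, wedge_wedge_comm, map_neg, contr_wedge, if_neg hij, zero_sub,
      neg_neg]
  have hTmem : ∀ i k u, u ∈ ⋀[A]^k (Fin p → A) →
      wedge i (B.coordMap (T i) u) ∈ ⋀[A]^(k + 1) (Fin p → A) := fun i k u hu =>
    wedge_mem_exteriorPower i (coordMap_mem_exteriorPower _ hu)
  clear_value π B
  have hprod_wedge : ∀ (l : List (Fin p)) j u,
      (j ∈ l → (l.map π).prod (wedge j u) = 0) ∧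
      (j ∉ l → (l.map π).prod (wedge j u) = wedge j ((l.map π).prod u)) := by
    intro l j
    induction l with
    | nil => simp
    | cons i l ih =>
      intro u
      simp only [List.map_cons, List.prod_cons, hmul, List.mem_cons]
      by_cases hjl : j ∈ l
      · simp [hjl, (ih u).1 hjl]
      · rw [(ih u).2 hjl]
        by_cases hji : j = i
        · subst hji
          simp [hπ_self]
        · simp [hjl, hji, hπ_wedge _ _ _ hji]
  have hprod_zero : ∀ u ∈ ⋀[A]^(k + 1) (Fin p → A), ((List.finRange p).map π).prod u = 0 := by
    intro u hu
    rw [ExteriorAlgebra.exteriorPower, pow_succ'] at hu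
    induction hu using Submodule.mul_induction_on' with
    | mem_mul_mem u hu b hb =>
      obtain ⟨v, rfl⟩ := hu
      -- The `π i` are only additive, so the scalars `v j` are moved into the second factor, leaving
      -- plain basis vectors in front.
      have hv : ExteriorAlgebra.ι A v * b = ∑ j, wedge j (v j • b) := by
        conv_lhs => rw [pi_eq_sum_univ' v]
        simp [wedge, Finset.sum_mul]
      rw [hv, map_sum]
      exact Finset.sum_eq_zero fun j _ => (hprod_wedge _ j _).1 (List.mem_finRange j)
    | add a _ b _ ha hb => rw [map_add, ha, hb, add_zero]
  -- The homotopies telescope: each `π i` changes a cycle by a boundary, so its output is again a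
  -- cycle.
  have hchain : ∀ (l : List (Fin p)) u, u ∈ ⋀[A]^(k + 1) (Fin p → A) → koszulContr x u = 0 →
      (l.map π).prod u ∈ ⋀[A]^(k + 1) (Fin p → A) ∧ koszulContr x ((l.map π).prod u) = 0 ∧
      ∃ y ∈ ⋀[A]^(k + 2) (Fin p → A), koszulContr x y = u - (l.map π).prod u := by
    intro l u hu hu0
    induction l with
    | nil => exact ⟨hu, hu0, 0, zero_mem _, by simp⟩
    | cons i l ih =>
      obtain ⟨h1, h2, y, hy, hyu⟩ := ih
      simp only [List.map_cons, List.prod_cons, hmul]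
      generalize (l.map π).prod u = v at *
      have h3 := hhom i v h2
      refine ⟨hπmem _ _ _ h1, ?_, y + wedge i (B.coordMap (T i) v), add_mem hy (hTmem _ _ _ h1), ?_⟩
      · rw [eq_sub_iff_add_eq, ← eq_sub_iff_add_eq'] at h3
        rw [h3, map_sub, koszulContr_koszulContr, h2, sub_zero]
      · rw [map_add, hyu, h3]
        abel
  intro u
  constructor
  · intro hu
    have hu0 : koszulContr x (u : ExteriorAlgebra A (Fin p → A)) = 0 := congrArg Subtype.val hu
    obtain ⟨-, -, y, hy, hyu⟩ := hchain (List.finRange p) u u.2 hu0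
    rw [hprod_zero _ u.2, sub_zero] at hyu
    exact ⟨⟨y, hy⟩, Subtype.ext hyu⟩
  · rintro ⟨y, rfl⟩
    exact Subtype.ext (koszulContr_koszulContr x _)

end KoszulExact

/-! ### Koszul complexes and complements of principal ideals -/

section Complement

variable {A : Type*} [CommRing A]

/-- If every element of `A` is uniquely of the form `d + x * q` with `d ∈ D`, then the quotient `q`
is an additive function. -/
theorem exists_quotientMap (x : A) (D : AddSubgroup A) (hD : ∀ a, ∃ q, a - x * q ∈ D)
    (hD' : ∀ q, x * q ∈ D → q = 0) : ∃ T : A →+ A, ∀ a q, a - x * q ∈ D → T a = q := by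
  choose T hT using hD
  have huniq : ∀ a q, a - x * q ∈ D → T a = q := by
    intro a q hq
    rw [← sub_eq_zero]
    refine hD' _ ?_
    have := sub_mem hq (hT a)
    convert this using 1
    ring
  refine ⟨AddMonoidHom.mk' T fun a c => huniq _ _ ?_, huniq⟩
  have := add_mem (hT a) (hT c)
  convert this using 1
  ring

variable {p : ℕ}

/-- The quotients of division by `x i` with remainder in `D i` serve as the operators of
`koszulDifferential_exact`. Multiplying a division by `x j`, `j ≠ i`, gives another valid division
because `D i` is stable under `x j`. -/
theorem koszulDifferential_exact_of_complement (x : Fin p → A) (D : Fin p → AddSubgroup A)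
    (hD : ∀ i a, ∃ q, a - x i * q ∈ D i) (hD' : ∀ i q, x i * q ∈ D i → q = 0)
    (hx : ∀ i j, j ≠ i → ∀ a ∈ D i, x j * a ∈ D i) (k : ℕ) :
    Function.Exact (koszulDifferential x (k + 1)) (koszulDifferential x k) := by
  choose T hT using fun i => exists_quotientMap (x i) (D i) (hD i) (hD' i)
  refine koszulDifferential_exact x T (fun i a => hT i _ _ (by simp)) (fun i j hij a => ?_) k
  obtain ⟨q, hq⟩ := hD i a
  rw [hT i a q hq]
  refine hT i _ _ ?_
  have := hx i j hij _ hq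
  convert this using 1
  ring

/-- If each element of `A` is uniquely the sum of an element fixed by `ρ i` and a multiple of
`x i`, then modulo the ideal of all `x i` each element is fixed by all `ρ i`. -/
theorem exists_fixed_sub_mem_span (x : Fin p → A) (ρ : Fin p → A →+ A)
    (hD : ∀ i a, ∃ q, ρ i (a - x i * q) = a - x i * q)
    (hD' : ∀ i q, ρ i (x i * q) = x i * q → q = 0)
    (hx : ∀ i j, j ≠ i → ∀ a, ρ j (x i * a) = x i * ρ j a)
    (hρ : ∀ i j a, ρ i (ρ j a) = ρ j (ρ i a)) (a : A) :
    ∃ a₀, (∀ i, ρ i a₀ = a₀) ∧ a - a₀ ∈ Ideal.span (Set.range x) := by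
  have key : ∀ l : List (Fin p),
      ∃ a₀, (∀ i ∈ l, ρ i a₀ = a₀) ∧ a - a₀ ∈ Ideal.span (Set.range x) := by
    intro l
    induction l with
    | nil => exact ⟨a, by simp, by simp⟩
    | cons i l ih =>
      obtain ⟨a₀, h₀, h₁⟩ := ih
      obtain ⟨q, hq⟩ := hD i a₀
      refine ⟨a₀ - x i * q, fun j hj => ?_, ?_⟩
      · by_cases hji : j = i
        · rw [hji, hq]
        · have hj' : ρ j a₀ = a₀ := h₀ j ((List.mem_cons.1 hj).resolve_left hji)
          -- Dividing by `x i` must not spoil invariance under an earlier `ρ j`. Applying `ρ j` to a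
          -- division of `a₀ = ρ j a₀` by `x i` gives another one, so uniqueness forces `ρ j q = q`.
          have h : ρ j q - q = 0 := by
            refine hD' i _ ?_
            have h2 := hρ j i (a₀ - x i * q)
            rw [hq] at h2
            have h3 : x i * (ρ j q - q) = (a₀ - x i * q) - ρ j (a₀ - x i * q) := by
              rw [map_sub, hx i j hji, hj']
              ring
            rw [h3, map_sub, hq, ← h2]
          rw [map_sub, hj', hx i j hji, sub_eq_zero.1 h]
      · have h2 : a - (a₀ - x i * q) = (a - a₀) + q * x i := by ring
        rw [h2]
        exact add_mem h₁ (Ideal.mul_mem_left _ _ (Ideal.subset_span ⟨i, rfl⟩))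
  obtain ⟨a₀, h₀, h₁⟩ := key (List.finRange p)
  exact ⟨a₀, fun i => h₀ i (List.mem_finRange i), h₁⟩

end Complement

/-! ### Division in tensor products -/

section TensorDivision

open Polynomial

variable {R S B : Type*} [CommRing R] [CommRing S] [CommRing B] [Algebra R S] [Algebra R B]

/-- The endomorphism `ρ ⊗ id` of `S ⊗ B`. -/
noncomputable def tensorMap (B : Type*) [CommRing B] [Algebra R B] (ρ : S →ₐ[R] S) :
    S ⊗[R] B →ₐ[R] S ⊗[R] B :=
  Algebra.TensorProduct.map ρ (AlgHom.id R B)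

@[simp]
theorem tensorMap_tmul (ρ : S →ₐ[R] S) (s : S) (c : B) :
    tensorMap B ρ (s ⊗ₜ c) = ρ s ⊗ₜ c := rfl

theorem tensorMap_comm {ρ σ : S →ₐ[R] S} (h : ∀ s, ρ (σ s) = σ (ρ s)) (a : S ⊗[R] B) :
    tensorMap B ρ (tensorMap B σ a) = tensorMap B σ (tensorMap B ρ a) := by
  induction a with
  | zero => simp
  | tmul s c => simp [h]
  | add a c ha hc => simp only [map_add, ha, hc]

theorem repr_tensorMap {ι : Type*} (β : Module.Basis ι R B) (ρ : S →ₐ[R] S) (a : S ⊗[R] B)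
    (k : ι) : (Algebra.TensorProduct.basis S β).repr (tensorMap B ρ a) k =
      ρ ((Algebra.TensorProduct.basis S β).repr a k) := by
  induction a with
  | zero => simp
  | tmul s c => simp [Algebra.TensorProduct.basis_repr_tmul]
  | add a c ha hc => simp only [map_add, Finsupp.add_apply, ha, hc]

variable (z : S) (b : B) (ρ : S →ₐ[R] S) (P : R[X])

/-- The difference of two elements divides the difference of the values of `P` at them, and `P`
vanishes at `1 ⊗ b`. -/
theorem dvd_aeval_tmul (hPb : aeval b P = 0) :
    (z ⊗ₜ 1 - 1 ⊗ₜ b : S ⊗[R] B) ∣ aeval z P ⊗ₜ 1 := by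
  have h := sub_dvd_eval_sub (z ⊗ₜ 1 : S ⊗[R] B) (1 ⊗ₜ b) (P.map (algebraMap R (S ⊗[R] B)))
  have h1 : aeval (z ⊗ₜ 1 : S ⊗[R] B) P = aeval z P ⊗ₜ 1 :=
    aeval_algHom_apply (Algebra.TensorProduct.includeLeft : S →ₐ[R] S ⊗[R] B) z P
  have h2 : aeval (1 ⊗ₜ b : S ⊗[R] B) P = 1 ⊗ₜ aeval b P :=
    aeval_algHom_apply (Algebra.TensorProduct.includeRight : B →ₐ[R] S ⊗[R] B) b P
  rwa [eval_map_algebraMap, eval_map_algebraMap, h1, h2, hPb, TensorProduct.tmul_zero,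
    sub_zero] at h

/-- Existence of division by `z ⊗ 1 - 1 ⊗ b`, from division by a monic equation of `b`. -/
theorem exists_fixed_sub_mul_tmul_sub (hPb : aeval b P = 0)
    (hdiv : ∀ f : S, ∃ q, f - aeval z P * q ∈
      AddSubgroup.closure {s | ∃ r k, ρ r = r ∧ s = r * z ^ k}) (a : S ⊗[R] B) :
    ∃ q, tensorMap B ρ (a - (z ⊗ₜ 1 - 1 ⊗ₜ b) * q) = a - (z ⊗ₜ 1 - 1 ⊗ₜ b) * q := by
  set x : S ⊗[R] B := z ⊗ₜ 1 - 1 ⊗ₜ b with hx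
  suffices h : ∃ d, tensorMap B ρ d = d ∧ x ∣ a - d by
    obtain ⟨d, hd, q, hq⟩ := h
    refine ⟨q, ?_⟩
    rw [← hq, sub_sub_cancel, hd]
  have hadd : ∀ a c : S ⊗[R] B, (∃ d, tensorMap B ρ d = d ∧ x ∣ a - d) →
      (∃ d, tensorMap B ρ d = d ∧ x ∣ c - d) → ∃ d, tensorMap B ρ d = d ∧ x ∣ a + c - d := by
    rintro a c ⟨d, hd, h⟩ ⟨d', hd', h'⟩
    exact ⟨d + d', by rw [map_add, hd, hd'], by rw [add_sub_add_comm]; exact dvd_add h h'⟩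
  induction a with
  | zero => exact ⟨0, by simp, by simp⟩
  | add a c ha hc => exact hadd a c ha hc
  | tmul f c =>
    obtain ⟨q, hq⟩ := hdiv f
    -- The first summand is a multiple of `x`. In the second, powers of `z ⊗ 1` may be replaced by
    -- powers of `1 ⊗ b` modulo `x`, which removes `z` and leaves coefficients fixed by `ρ`.
    have hf : f ⊗ₜ[R] c = (aeval z P ⊗ₜ 1) * (q ⊗ₜ c) + (f - aeval z P * q) ⊗ₜ c := by
      rw [Algebra.TensorProduct.tmul_mul_tmul, one_mul, ← TensorProduct.add_tmul,
        add_sub_cancel]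
    rw [hf]
    refine hadd _ _ ⟨0, by simp, ?_⟩ ?_
    · rw [sub_zero]
      exact (dvd_aeval_tmul z b P hPb).mul_right _
    · generalize f - aeval z P * q = g at hq
      induction hq using AddSubgroup.closure_induction with
      | mem g hg =>
        obtain ⟨r, k, hr, rfl⟩ := hg
        refine ⟨r ⊗ₜ (b ^ k * c), by simp [hr], ?_⟩
        have h : (r * z ^ k) ⊗ₜ[R] c - r ⊗ₜ (b ^ k * c) =
            ((z ⊗ₜ 1) ^ k - (1 ⊗ₜ b) ^ k) * (r ⊗ₜ c) := by
          rw [sub_mul, Algebra.TensorProduct.tmul_pow, Algebra.TensorProduct.tmul_pow,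
            Algebra.TensorProduct.tmul_mul_tmul, Algebra.TensorProduct.tmul_mul_tmul]
          simp [mul_comm]
        rw [h]
        exact (sub_dvd_pow_sub_pow _ _ k).mul_right _
      | zero => exact ⟨0, by simp, by simp⟩
      | add g h _ _ hg hh => rw [TensorProduct.add_tmul]; exact hadd _ _ hg hh
      | neg g _ hg =>
        obtain ⟨d, hd, h⟩ := hg
        refine ⟨-d, by rw [map_neg, hd], ?_⟩
        rw [TensorProduct.neg_tmul, ← neg_sub', dvd_neg]
        exact h

/-- Uniqueness of division by `z ⊗ 1 - 1 ⊗ b`, from uniqueness of the division by an equation of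
`b`. -/
theorem eq_zero_of_tmul_sub_mul_fixed {ι : Type*} (β : Module.Basis ι R B) (hPb : aeval b P = 0)
    (huniq : ∀ (q : S) (r : ℕ → S), (∀ l, ρ (r l) = r l) →
      aeval z P * q = ∑ l ∈ Finset.range P.natDegree, r l * z ^ l → q = 0)
    (q : S ⊗[R] B)
    (hq : tensorMap B ρ ((z ⊗ₜ 1 - 1 ⊗ₜ b) * q) = (z ⊗ₜ 1 - 1 ⊗ₜ b) * q) : q = 0 := by
  set m := P.natDegree with hm
  set r : S ⊗[R] B := (z ⊗ₜ 1 - 1 ⊗ₜ b) * q with hr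
  -- Expand `(P(z ⊗ 1) - P(1 ⊗ b)) * q` by the geometric sum formula and collect powers of `z ⊗ 1`:
  -- the coefficient of the `j`-th power is `c j`. It is fixed because `r` and `1 ⊗ b` are.
  -- Uniqueness in `S` then applies to each coordinate with respect to `β`.
  let c : ℕ → S ⊗[R] B := fun j => ∑ l ∈ Finset.range (m + 1),
    if j < l then algebraMap R _ (P.coeff l) * ((1 ⊗ₜ b) ^ (l - 1 - j) * r) else 0
  have hc : ∀ j, tensorMap B ρ (c j) = c j := by
    intro j
    simp only [c, map_sum]
    refine Finset.sum_congr rfl fun l _ => ?_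
    split_ifs
    · rw [map_mul, map_mul, map_pow, hq, AlgHom.commutes, tensorMap_tmul, map_one]
    · exact map_zero _
  have key : (aeval z P ⊗ₜ 1 : S ⊗[R] B) * q = ∑ j ∈ Finset.range m, (z ⊗ₜ 1) ^ j * c j := by
    have h1 : aeval (z ⊗ₜ 1 : S ⊗[R] B) P = aeval z P ⊗ₜ 1 :=
      aeval_algHom_apply (Algebra.TensorProduct.includeLeft : S →ₐ[R] S ⊗[R] B) z P
    have h2 : aeval (1 ⊗ₜ b : S ⊗[R] B) P = 0 := by
      have := aeval_algHom_apply (Algebra.TensorProduct.includeRight : B →ₐ[R] S ⊗[R] B) b P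
      rw [hPb, map_zero] at this
      exact this
    have h3 : (aeval z P ⊗ₜ 1 : S ⊗[R] B) * q =
        (aeval (z ⊗ₜ 1 : S ⊗[R] B) P - aeval (1 ⊗ₜ b : S ⊗[R] B) P) * q := by
      rw [h1, h2, sub_zero]
    rw [h3, aeval_eq_sum_range, aeval_eq_sum_range, ← Finset.sum_sub_distrib, Finset.sum_mul]
    simp only [c, Finset.mul_sum]
    rw [Finset.sum_comm]
    refine Finset.sum_congr rfl fun l hl => ?_
    have hl' : l ≤ m := Nat.lt_succ_iff.1 (Finset.mem_range.1 hl)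
    have hfil : (Finset.range m).filter (fun j => j < l) = Finset.range l := by
      ext j
      simp only [Finset.mem_filter, Finset.mem_range]
      omega
    simp only [mul_ite, mul_zero]
    rw [← Finset.sum_filter, hfil, ← smul_sub, ← geom_sum₂_mul, Algebra.smul_def, mul_assoc,
      mul_assoc, ← hr, Finset.sum_mul, Finset.mul_sum]
    exact Finset.sum_congr rfl fun j _ => by ring
  refine (Algebra.TensorProduct.basis S β).ext_elem fun k => ?_
  rw [map_zero, Finsupp.zero_apply]
  refine huniq _ (fun j => (Algebra.TensorProduct.basis S β).repr (c j) k) (fun j => ?_) ?_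
  · rw [← repr_tensorMap, hc]
  · have hsm : ∀ (s : S) (a : S ⊗[R] B), (s ⊗ₜ 1 : S ⊗[R] B) * a = s • a := fun s a => by
      rw [Algebra.smul_def]; rfl
    have h4 := congrArg (fun a => (Algebra.TensorProduct.basis S β).repr a k) key
    simp only [map_sum, Algebra.TensorProduct.tmul_pow, one_pow, hsm, map_smul,
      Finsupp.smul_apply, smul_eq_mul, Finsupp.finsetSum_apply] at h4
    rw [h4]
    exact Finset.sum_congr rfl fun j _ => mul_comm _ _

end TensorDivision

/-! ### Koszul complexes on tensor products, and characteristic polynomials -/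

section TensorKoszul

open Polynomial

variable {R S B : Type*} [CommRing R] [CommRing S] [CommRing B] [Algebra R S] [Algebra R B]

/-- The Koszul complex of the elements `z i ⊗ 1 - 1 ⊗ b i` of `S ⊗ B` is exact in positive degrees
and every element of `S ⊗ B` is congruent to an element of `B` modulo them, if `S` admits unique
division by monic equations of the `b i`, evaluated at `z i`. -/
theorem koszulDifferential_exact_tmul_sub {ι : Type*} [Fintype ι] (β : Module.Basis ι R B) {p : ℕ}
    (z : Fin p → S) (b : Fin p → B) (ρ : Fin p → S →ₐ[R] S) (P : Fin p → R[X])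
    (hPb : ∀ i, aeval (b i) (P i) = 0)
    (hdiv : ∀ i (f : S), ∃ q, f - aeval (z i) (P i) * q ∈
      AddSubgroup.closure {s | ∃ r k, ρ i r = r ∧ s = r * z i ^ k})
    (huniq : ∀ i (q : S) (r : ℕ → S), (∀ l, ρ i (r l) = r l) →
      aeval (z i) (P i) * q = ∑ l ∈ Finset.range (P i).natDegree, r l * z i ^ l → q = 0)
    (hz : ∀ i j, j ≠ i → ρ j (z i) = z i) (hρ : ∀ i j s, ρ i (ρ j s) = ρ j (ρ i s))
    (hfix : ∀ s, (∀ i, ρ i s = s) → s ∈ (algebraMap R S).range) :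
    (∀ k, Function.Exact
      (koszulDifferential (fun i => (z i ⊗ₜ 1 - 1 ⊗ₜ b i : S ⊗[R] B)) (k + 1))
      (koszulDifferential (fun i => (z i ⊗ₜ 1 - 1 ⊗ₜ b i : S ⊗[R] B)) k)) ∧
    ∀ a : S ⊗[R] B, ∃ c : B, a - 1 ⊗ₜ c ∈
      Ideal.span (Set.range fun i => (z i ⊗ₜ 1 - 1 ⊗ₜ b i : S ⊗[R] B)) := by
  have hD := fun i => exists_fixed_sub_mul_tmul_sub (z i) (b i) (ρ i) (P i) (hPb i) (hdiv i)
  have hD' := fun i => eq_zero_of_tmul_sub_mul_fixed (z i) (b i) (ρ i) (P i) β (hPb i) (huniq i)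
  have hx : ∀ i j, j ≠ i → ∀ a, tensorMap B (ρ j) ((z i ⊗ₜ 1 - 1 ⊗ₜ b i) * a) =
      (z i ⊗ₜ 1 - 1 ⊗ₜ b i) * tensorMap B (ρ j) a := by
    intro i j hij a
    simp [hz i j hij]
  refine ⟨fun k => koszulDifferential_exact_of_complement _
    (fun i => ((tensorMap B (ρ i) : S ⊗[R] B →+ S ⊗[R] B) - AddMonoidHom.id _).ker)
    (fun i a => ?_) (fun i q hq => hD' i q ?_) (fun i j hij a ha => ?_) k, fun a => ?_⟩
  · obtain ⟨q, hq⟩ := hD i a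
    exact ⟨q, by simpa [AddMonoidHom.mem_ker, sub_eq_zero] using hq⟩
  · rw [AddMonoidHom.mem_ker, AddMonoidHom.sub_apply, sub_eq_zero] at hq
    exact hq
  · rw [AddMonoidHom.mem_ker, AddMonoidHom.sub_apply, sub_eq_zero] at ha ⊢
    exact (hx j i hij.symm a).trans (congrArg _ ha)
  · obtain ⟨a₀, h₀, h₁⟩ := exists_fixed_sub_mem_span _
      (fun i => (tensorMap B (ρ i) : S ⊗[R] B →+ S ⊗[R] B)) hD hD' hx
      (fun i j => tensorMap_comm (hρ i j)) a
    -- The coordinates of the remainder are fixed by every `ρ i`, hence come from `R` and can be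
    -- moved across the tensor sign.
    have hcoord : ∀ k, ∃ r, algebraMap R S r = (Algebra.TensorProduct.basis S β).repr a₀ k := by
      intro k
      refine hfix _ fun i => ?_
      rw [← repr_tensorMap]
      exact congrArg (fun a => (Algebra.TensorProduct.basis S β).repr a k) (h₀ i)
    choose r hr using hcoord
    refine ⟨∑ k, r k • β k, ?_⟩
    have : a₀ = 1 ⊗ₜ ∑ k, r k • β k := by
      rw [← (Algebra.TensorProduct.basis S β).sum_repr a₀, TensorProduct.tmul_sum]
      refine Finset.sum_congr rfl fun k _ => ?_
      rw [← hr, algebraMap_smul, Algebra.TensorProduct.basis_apply, TensorProduct.tmul_smul]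
    rwa [← this]

/-- The characteristic polynomial of an element `b` of a free algebra reduces to a power of `X` at a
rational point `ev`, if `c - b` is a unit for all nonzero constants `c`. -/
theorem exists_monic_aeval_eq_zero {K : Type*} [Field K] [IsAlgClosed K] [Module.Free R B]
    [Module.Finite R B] (ev : R →+* K) (const : K → R) (hev : ∀ c, ev (const c) = c) (b : B)
    (hb : ∀ c ≠ 0, IsUnit (algebraMap R B (const c) - b)) :
    ∃ P : R[X], P.Monic ∧ aeval b P = 0 ∧ ∀ l < P.natDegree, ev (P.coeff l) = 0 := by
  refine ⟨(Algebra.lmul R B b).charpoly, LinearMap.charpoly_monic _, ?_, ?_⟩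
  · have h := LinearMap.aeval_self_charpoly (Algebra.lmul R B b)
    rw [aeval_algHom_apply] at h
    have h1 := congrArg (fun f : Module.End R B => f 1) h
    simpa using h1
  · set P := (Algebra.lmul R B b).charpoly with hP
    have hmonic : P.Monic := LinearMap.charpoly_monic _
    -- The value of the characteristic polynomial at `const c` is the determinant of multiplication
    -- by `c - b`. For `c ≠ 0` this is a unit, so `ev` does not kill it.
    have hroots : ∀ c, (P.map ev).eval c = 0 → c = 0 := by
      intro c hc
      by_contra hne
      have h1 : ev (P.eval (const c)) = 0 := by
        rw [← hc, ← hev c, eval_map, eval₂_hom, hev c]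
      rw [hP, LinearMap.eval_charpoly] at h1
      have h2 : algebraMap R (Module.End R B) (const c) - Algebra.lmul R B b =
          Algebra.lmul R B (algebraMap R B (const c) - b) := by
        rw [map_sub, AlgHom.commutes]
      rw [h2] at h1
      exact ((((hb c hne).map (Algebra.lmul R B)).map LinearMap.det).map ev).ne_zero h1
    have hX : P.map ev = X ^ P.natDegree := by
      have hm := hmonic.map ev
      have hroots' : (P.map ev).roots = Multiset.replicate (P.map ev).roots.card 0 :=
        Multiset.eq_replicate_card.2 fun c hc => hroots c (isRoot_of_mem_roots hc)
      have hprod := (IsAlgClosed.splits (P.map ev)).eq_prod_roots_of_monic hm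
      have hcard : (P.map ev).roots.card = P.natDegree := by
        rw [← (IsAlgClosed.splits (P.map ev)).natDegree_eq_card_roots, hmonic.natDegree_map]
      rw [hroots', hcard] at hprod
      simpa using hprod
    intro l hl
    have := congrArg (fun p : K[X] => p.coeff l) hX
    simpa [coeff_X_pow, hl.ne] using this

end TensorKoszul

/-! ### Germs of holomorphic functions in coordinates -/

section GermsInCoordinates

open Polynomial

/-- The ring of functions on a complex vector space that are holomorphic near `v`. -/
def holFun {V : Type*} [NormedAddCommGroup V] [NormedSpace ℂ V] (v : V) : Subring (V → ℂ) where
  carrier := {f | ∀ᶠ u in 𝓝 v, DifferentiableAt ℂ f u}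
  mul_mem' hf hg := by filter_upwards [hf, hg] with u h₁ h₂ using h₁.mul h₂
  add_mem' hf hg := by filter_upwards [hf, hg] with u h₁ h₂ using h₁.add h₂
  one_mem' := Eventually.of_forall fun _ => differentiableAt_const _
  zero_mem' := Eventually.of_forall fun _ => differentiableAt_const _
  neg_mem' hf := by filter_upwards [hf] with u h using h.neg

variable {V V' : Type*} [NormedAddCommGroup V] [NormedSpace ℂ V] [NormedAddCommGroup V']
  [NormedSpace ℂ V']

/-- Composition with a holomorphic map. -/
noncomputable def holFun.comp {v : V} {v' : V'} (h : V → V') (hd : Differentiable ℂ h)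
    (hv : h v = v') : holFun v' →+* holFun v where
  toFun f := ⟨f.1 ∘ h, by
    have ht : Tendsto h (𝓝 v) (𝓝 v') := hv ▸ hd.continuous.continuousAt
    filter_upwards [ht.eventually f.2] with u hu using hu.comp u (hd u)⟩
  map_one' := rfl
  map_mul' _ _ := rfl
  map_zero' := rfl
  map_add' _ _ := rfl

/-- The germ of a function that is holomorphic near `v`. -/
noncomputable def holFun.germ (v : V) : holFun v →+* HolRing V v where
  toFun f := germOf f.1 v (f.2.mono fun _ hu => hu.mdifferentiableAt)
  map_one' := rfl
  map_mul' _ _ := rfl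
  map_zero' := rfl
  map_add' _ _ := rfl

theorem holFun.germ_surjective (v : V) : Function.Surjective (holFun.germ v) := by
  rintro ⟨_, f, rfl, hf⟩
  exact ⟨⟨f, hf.mono fun u hu => hu.differentiableAt⟩, rfl⟩

/-- The value of a germ at its base point. -/
noncomputable def holValue (v : V) : HolRing V v →+* ℂ :=
  (Germ.valueRingHom (X := V) (E := ℂ) (x := v)).comp (holGerm V v).subtype

variable {E : Type*} [NormedAddCommGroup E] [NormedSpace ℂ E]
  {X : Type*} [TopologicalSpace X] [ChartedSpace E X] {p n : ℕ}

namespace HolCoordinates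

variable (φ : HolCoordinates E X p n) (ζ : φ.chart.source)

/-- The germ on `X` of a holomorphic function of the coordinates. -/
noncomputable def ofModel : holFun (φ.chart ζ) →+* HolRing E (ζ : X) :=
  (holGermPullback φ.chart (ζ : X) (φ.eventually_holo ζ)).comp (holFun.germ (φ.chart ζ))

theorem ofModel_eq_zero_iff {f : holFun (φ.chart ζ)} :
    φ.ofModel ζ f = 0 ↔ ∀ᶠ v in 𝓝 (φ.chart ζ), f.1 v = 0 := by
  have h : φ.ofModel ζ f = 0 ↔
      ((f.1 ∘ φ.chart : X → ℂ) : Germ (𝓝 (ζ : X)) ℂ) = ((0 : X → ℂ) : Germ (𝓝 (ζ : X)) ℂ) :=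
    ⟨fun h => congrArg Subtype.val h, fun h => Subtype.ext h⟩
  rw [h, Germ.coe_eq, ← φ.chart.map_nhds_eq ζ.2, eventually_map]
  rfl

theorem ofModel_eq_iff {f g : holFun (φ.chart ζ)} :
    φ.ofModel ζ f = φ.ofModel ζ g ↔ ∀ᶠ v in 𝓝 (φ.chart ζ), f.1 v = g.1 v := by
  rw [← sub_eq_zero, ← map_sub, ofModel_eq_zero_iff]
  simp [sub_eq_zero]

/-- Compose with the inverse chart. This reduces identities between germs on `X` to identities
between functions of `(z, w)`. -/
theorem ofModel_surjective : Function.Surjective (φ.ofModel ζ) := by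
  rintro ⟨_, f, rfl, hf⟩
  have hsymm : φ.chart.symm (φ.chart ζ) = ζ := φ.chart.left_inv ζ.2
  have ht : Tendsto φ.chart.symm (𝓝 (φ.chart ζ)) (𝓝 (ζ : X)) := by
    have := φ.chart.symm.continuousAt (φ.chart.map_source ζ.2)
    rwa [ContinuousAt, hsymm] at this
  refine ⟨⟨f ∘ φ.chart.symm, ?_⟩, Subtype.ext ?_⟩
  · filter_upwards [ht.eventually hf, φ.chart.open_target.mem_nhds (φ.chart.map_source ζ.2)]
      with v hv hvt
    have h1 := (φ.holo_symm v hvt).mdifferentiableAt (φ.chart.open_target.mem_nhds hvt)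
    exact (hv.comp v h1).differentiableAt
  · refine Germ.coe_eq.2 ?_
    filter_upwards [φ.chart.open_source.mem_nhds ζ.2] with y hy
    exact congrArg f (φ.chart.left_inv hy)

/-- The germ on `W` of a holomorphic function of `w`. -/
noncomputable def baseGerm : holFun (φ.w ζ) →+* φ.baseRing ζ := holFun.germ (φ.w ζ)

theorem baseGerm_surjective : Function.Surjective (φ.baseGerm ζ) := holFun.germ_surjective _

/-- The value at the base point of a germ on `W`. -/
noncomputable def baseValue : φ.baseRing ζ →+* ℂ := holValue (φ.w ζ)

theorem baseValue_baseGerm (a : holFun (φ.w ζ)) :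
    φ.baseValue ζ (φ.baseGerm ζ a) = a.1 (φ.w ζ) := rfl

theorem algebraMap_baseGerm (a : holFun (φ.w ζ)) :
    algebraMap (φ.baseRing ζ) (HolRing E (ζ : X)) (φ.baseGerm ζ a) =
      φ.ofModel ζ (holFun.comp (v := φ.chart ζ) Prod.snd differentiable_snd rfl a) := rfl

/-- The coordinate function `z_i` on the model space. -/
noncomputable def coordFun (i : Fin p) : holFun (φ.chart ζ) :=
  ⟨fun v => v.1 i, Eventually.of_forall fun v => by fun_prop⟩

theorem ofModel_coordFun (i : Fin p) : φ.ofModel ζ (φ.coordFun ζ i) = φ.zGerm ζ i := rfl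

end HolCoordinates

/-- Replace the `i`-th of the coordinates `z` by `t`. -/
def updateCoord (i : Fin p) (t : ℂ) (v : (Fin p → ℂ) × (Fin n → ℂ)) :
    (Fin p → ℂ) × (Fin n → ℂ) := (Function.update v.1 i t, v.2)

theorem differentiable_updateCoord (i : Fin p) :
    Differentiable ℂ fun u : ℂ × ((Fin p → ℂ) × (Fin n → ℂ)) => updateCoord i u.1 u.2 := by
  refine Differentiable.prodMk (differentiable_pi.2 fun j => ?_) (by fun_prop)
  by_cases h : j = i
  · subst h
    simp only [Function.update_self]
    fun_prop
  · simp only [Function.update_of_ne h]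
    fun_prop

theorem differentiable_updateCoord_right (i : Fin p) (t : ℂ) :
    Differentiable ℂ (updateCoord (n := n) i t) :=
  (differentiable_updateCoord i).comp (f := fun v => (t, v)) (by fun_prop)

@[simp]
theorem updateCoord_updateCoord (i : Fin p) (s t : ℂ) (v : (Fin p → ℂ) × (Fin n → ℂ)) :
    updateCoord i s (updateCoord i t v) = updateCoord i s v := by
  simp [updateCoord]

@[simp]
theorem updateCoord_self (i : Fin p) (v : (Fin p → ℂ) × (Fin n → ℂ)) :
    updateCoord i (v.1 i) v = v := by
  simp [updateCoord]

theorem updateCoord_comm {i j : Fin p} (s t : ℂ) (h : i ≠ j) (v : (Fin p → ℂ) × (Fin n → ℂ)) :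
    updateCoord i s (updateCoord j t v) = updateCoord j t (updateCoord i s v) := by
  simp only [updateCoord]
  rw [Function.update_comm h.symm]

/-! ### Forgetting a coordinate, and Weierstrass division of germs -/

namespace HolCoordinates

variable (φ : HolCoordinates E X p n) {ζ : φ.chart.source}

theorem updateCoord_chart (hζ : φ.z ζ = 0) (i : Fin p) : updateCoord i 0 (φ.chart ζ) = φ.chart ζ := by
  have h : (φ.chart ζ).1 = 0 := hζ
  refine Prod.ext ?_ rfl
  simp [updateCoord, h]

/-- Substituting `z_i = 0` is continuous and fixes the base point, so it preserves vanishing near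
that point. Hence the substitution is well defined on germs. -/
theorem ker_ofModel_le (hζ : φ.z ζ = 0) (i : Fin p) :
    RingHom.ker (φ.ofModel ζ) ≤ RingHom.ker ((φ.ofModel ζ).comp
      (holFun.comp (updateCoord i 0) (differentiable_updateCoord_right i 0)
        (φ.updateCoord_chart hζ i))) := by
  intro f hf
  rw [RingHom.mem_ker] at hf ⊢
  rw [RingHom.comp_apply, ofModel_eq_zero_iff]
  rw [ofModel_eq_zero_iff] at hf
  have hc := (differentiable_updateCoord_right (n := n) i 0).continuous.tendsto (φ.chart ζ)
  rw [φ.updateCoord_chart hζ i] at hc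
  exact hc.eventually hf

/-- The restriction of germs to `z_i = 0`, followed by the pull-back along the projection that
forgets `z_i`, as a ring homomorphism. -/
noncomputable def dropCoordRingHom (hζ : φ.z ζ = 0) (i : Fin p) :
    HolRing E (ζ : X) →+* HolRing E (ζ : X) :=
  (φ.ofModel ζ).liftOfSurjective (φ.ofModel_surjective ζ) ⟨_, φ.ker_ofModel_le hζ i⟩

theorem dropCoordRingHom_ofModel (hζ : φ.z ζ = 0) (i : Fin p) (f : holFun (φ.chart ζ)) :
    φ.dropCoordRingHom hζ i (φ.ofModel ζ f) = φ.ofModel ζ (holFun.comp (updateCoord i 0)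
      (differentiable_updateCoord_right i 0) (φ.updateCoord_chart hζ i) f) :=
  RingHom.liftOfSurjective_comp_apply _ (φ.ofModel_surjective ζ) _ _

/-- The restriction of germs to `z_i = 0`, followed by the pull-back along the projection that
forgets `z_i`. -/
noncomputable def dropCoord (hζ : φ.z ζ = 0) (i : Fin p) :
    HolRing E (ζ : X) →ₐ[φ.baseRing ζ] HolRing E (ζ : X) where
  __ := φ.dropCoordRingHom hζ i
  commutes' r := by
    obtain ⟨a, rfl⟩ := φ.baseGerm_surjective ζ r
    rw [algebraMap_baseGerm]
    exact φ.dropCoordRingHom_ofModel hζ i _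

theorem dropCoord_ofModel (hζ : φ.z ζ = 0) (i : Fin p) (f : holFun (φ.chart ζ)) :
    φ.dropCoord hζ i (φ.ofModel ζ f) = φ.ofModel ζ (holFun.comp (updateCoord i 0)
      (differentiable_updateCoord_right i 0) (φ.updateCoord_chart hζ i) f) :=
  φ.dropCoordRingHom_ofModel hζ i f

theorem dropCoord_zGerm (hζ : φ.z ζ = 0) {i j : Fin p} (h : j ≠ i) :
    φ.dropCoord hζ j (φ.zGerm ζ i) = φ.zGerm ζ i := by
  rw [← ofModel_coordFun, dropCoord_ofModel]
  congr 1
  refine Subtype.ext (funext fun v => ?_)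
  exact Function.update_of_ne h.symm _ _

theorem dropCoord_comm (hζ : φ.z ζ = 0) (i j : Fin p) (s : HolRing E (ζ : X)) :
    φ.dropCoord hζ i (φ.dropCoord hζ j s) = φ.dropCoord hζ j (φ.dropCoord hζ i s) := by
  obtain ⟨f, rfl⟩ := φ.ofModel_surjective ζ s
  by_cases h : i = j
  · rw [h]
  · simp only [dropCoord_ofModel]
    congr 1
    refine Subtype.ext (funext fun v => ?_)
    exact congrArg f.1 (updateCoord_comm 0 0 (Ne.symm h) v)

/-- A germ that does not depend on any `z_i` is the pull-back of a germ on `W`. -/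
theorem mem_range_of_dropCoord_eq (hζ : φ.z ζ = 0) (s : HolRing E (ζ : X))
    (hs : ∀ i, φ.dropCoord hζ i s = s) :
    s ∈ (algebraMap (φ.baseRing ζ) (HolRing E (ζ : X))).range := by
  obtain ⟨f, rfl⟩ := φ.ofModel_surjective ζ s
  have key : ∀ l : Finset (Fin p), ∃ g : holFun (φ.chart ζ), φ.ofModel ζ f = φ.ofModel ζ g ∧
      ∀ v, g.1 v = f.1 (fun j => if j ∈ l then 0 else v.1 j, v.2) := by
    intro l
    induction l using Finset.induction_on with
    | empty => exact ⟨f, rfl, fun v => by simp⟩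
    | insert i l hi ih =>
      obtain ⟨g, hg, hgv⟩ := ih
      refine ⟨_, ((hs i).symm.trans ?_).trans (φ.dropCoord_ofModel hζ i g), fun v => ?_⟩
      · rw [hg]
      · refine (hgv (updateCoord i 0 v)).trans (congrArg f.1 (Prod.ext (funext fun j => ?_) rfl))
        by_cases hji : j = i
        · simp [hji, updateCoord]
        · simp [hji, updateCoord]
  obtain ⟨g, hg, hgv⟩ := key Finset.univ
  have hmem : (fun w : Fin n → ℂ => f.1 ((0 : Fin p → ℂ), w)) ∈ holFun (φ.w ζ) := by
    have h0 : ((0 : Fin p → ℂ), φ.w ζ) = φ.chart ζ := Prod.ext hζ.symm rfl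
    have hd : Differentiable ℂ fun w : Fin n → ℂ => ((0 : Fin p → ℂ), w) := by fun_prop
    exact (holFun.comp _ hd h0 f).2
  refine ⟨φ.baseGerm ζ ⟨_, hmem⟩, ?_⟩
  rw [hg]
  refine (φ.algebraMap_baseGerm ζ _).trans ?_
  congr 1
  refine Subtype.ext (funext fun v => ?_)
  rw [hgv v]
  simp only [Finset.mem_univ, if_true]
  rfl

/-- A germ that takes a nonzero value is invertible. -/
theorem isUnit_ofModel (f : holFun (φ.chart ζ)) (hf : f.1 (φ.chart ζ) ≠ 0) :
    IsUnit (φ.ofModel ζ f) := by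
  have hne : ∀ᶠ v in 𝓝 (φ.chart ζ), f.1 v ≠ 0 :=
    f.2.self_of_nhds.continuousAt.eventually_ne hf
  have hmem : (fun v => (f.1 v)⁻¹) ∈ holFun (φ.chart ζ) := by
    filter_upwards [f.2, hne] with v h1 h2 using h1.inv h2
  refine IsUnit.of_mul_eq_one (φ.ofModel ζ ⟨_, hmem⟩) ?_
  rw [← map_mul, ← map_one (φ.ofModel ζ), ofModel_eq_iff]
  filter_upwards [hne] with v hv using mul_inv_cancel₀ hv

/-- Holomorphic representatives of the coefficients of a monic polynomial. -/
theorem exists_coeff_repr (P : (φ.baseRing ζ)[X]) (hP : P.Monic) :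
    ∃ a : ℕ → holFun (φ.w ζ), a P.natDegree = 1 ∧ ∀ l, φ.baseGerm ζ (a l) = P.coeff l := by
  choose a ha using fun l => φ.baseGerm_surjective ζ (P.coeff l)
  -- Weierstrass division needs a leading coefficient equal to `1` as a function, not only as a
  -- germ.
  refine ⟨Function.update a P.natDegree 1, by simp, fun l => ?_⟩
  by_cases h : l = P.natDegree
  · rw [h, Function.update_self, map_one, hP.coeff_natDegree]
  · rw [Function.update_of_ne h, ha]

theorem aeval_zGerm_eq (i : Fin p) (P : (φ.baseRing ζ)[X]) (a : ℕ → holFun (φ.w ζ))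
    (ha : ∀ l, φ.baseGerm ζ (a l) = P.coeff l) :
    aeval (φ.zGerm ζ i) P = φ.ofModel ζ (∑ l ∈ Finset.range (P.natDegree + 1),
      holFun.comp (v := φ.chart ζ) Prod.snd differentiable_snd rfl (a l) * φ.coordFun ζ i ^ l) := by
  rw [aeval_eq_sum_range, map_sum]
  refine Finset.sum_congr rfl fun l _ => ?_
  rw [map_mul, map_pow, ofModel_coordFun, ← algebraMap_baseGerm, ← ha, Algebra.smul_def]

theorem tendsto_updateCoord (hζ : φ.z ζ = 0) (i : Fin p) :
    Tendsto (fun u : ℂ × ((Fin p → ℂ) × (Fin n → ℂ)) => updateCoord i u.1 u.2)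
      (𝓝 (0, φ.chart ζ)) (𝓝 (φ.chart ζ)) := by
  have h := (differentiable_updateCoord (n := n) i).continuous.tendsto (0, φ.chart ζ)
  rwa [φ.updateCoord_chart hζ i] at h

/-- Existence of Weierstrass division in the ring of germs. -/
theorem exists_division (hζ : φ.z ζ = 0) (i : Fin p) (P : (φ.baseRing ζ)[X]) (hP : P.Monic)
    (hP0 : ∀ l < P.natDegree, φ.baseValue ζ (P.coeff l) = 0) (s : HolRing E (ζ : X)) :
    ∃ q, s - aeval (φ.zGerm ζ i) P * q ∈
      AddSubgroup.closure {s | ∃ r k, φ.dropCoord hζ i r = r ∧ s = r * φ.zGerm ζ i ^ k} := by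
  obtain ⟨f, rfl⟩ := φ.ofModel_surjective ζ s
  obtain ⟨a, ha1, ha⟩ := φ.exists_coeff_repr P hP
  let a' : ℕ → holFun (φ.chart ζ) := fun l =>
    holFun.comp (v := φ.chart ζ) Prod.snd differentiable_snd rfl (a l)
  have hz0 : (φ.chart ζ).1 i = 0 := congrFun hζ i
  -- The distinguished variable `t` is adjoined as an extra coordinate, with the whole model space
  -- as parameters. Putting `t = z_i` and setting `z_i` to zero in the parameters gives the division
  -- of `f`, with remainder coefficients independent of `z_i`.
  obtain ⟨q, I, hq, hI, hdiv⟩ := exists_weierstrass_division (m := P.natDegree)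
    (g := fun u => f.1 (updateCoord i u.1 u.2)) (y₀ := φ.chart ζ) (a := fun l => (a' l).1)
    (by
      filter_upwards [(φ.tendsto_updateCoord hζ i).eventually f.2] with u hu
      exact hu.comp u (differentiable_updateCoord i u))
    (fun l => (a' l).2)
    (fun l hl => by
      have := hP0 l hl
      rw [← ha, baseValue_baseGerm] at this
      exact this)
    (by simp only [a', ha1]; rfl)
  have hsplit : Differentiable ℂ fun v : (Fin p → ℂ) × (Fin n → ℂ) => (v.1 i, updateCoord i 0 v) :=
    Differentiable.prodMk (by fun_prop) (differentiable_updateCoord_right i 0)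
  have hsplit0 : (fun v : (Fin p → ℂ) × (Fin n → ℂ) => (v.1 i, updateCoord i 0 v)) (φ.chart ζ) =
      (0, φ.chart ζ) := Prod.ext hz0 (φ.updateCoord_chart hζ i)
  let q' : holFun (φ.chart ζ) := holFun.comp _ hsplit hsplit0 ⟨q, hq⟩
  let I' : ℕ → holFun (φ.chart ζ) := fun k => holFun.comp (updateCoord i 0)
    (differentiable_updateCoord_right i 0) (φ.updateCoord_chart hζ i) ⟨I k, hI k⟩
  have hfix : ∀ l k, φ.dropCoord hζ i (φ.ofModel ζ (a' l * I' k)) = φ.ofModel ζ (a' l * I' k) := by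
    intro l k
    rw [dropCoord_ofModel]
    congr 1
    refine Subtype.ext (funext fun v => ?_)
    change (a l).1 _ * I k _ = (a l).1 _ * I k _
    rw [updateCoord_updateCoord]
    rfl
  refine ⟨φ.ofModel ζ q', ?_⟩
  have key : φ.ofModel ζ f - aeval (φ.zGerm ζ i) P * φ.ofModel ζ q' =
      ∑ l ∈ Finset.range (P.natDegree + 1), ∑ j ∈ Finset.range l,
        φ.ofModel ζ (a' l * I' (l - 1 - j)) * φ.zGerm ζ i ^ j := by
    rw [sub_eq_iff_eq_add', φ.aeval_zGerm_eq i P a ha]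
    simp only [← ofModel_coordFun, ← map_mul, ← map_pow, ← map_sum, ← map_add]
    rw [ofModel_eq_iff]
    have ht := hsplit.continuous.tendsto' (φ.chart ζ) _ hsplit0
    filter_upwards [ht.eventually hdiv] with v hv
    simp only [updateCoord_updateCoord, updateCoord_self] at hv
    rw [hv]
    simp only [Subring.coe_add, Subring.coe_mul, Pi.add_apply, Pi.mul_apply,
      AddSubmonoidClass.coe_finsetSum, Finset.sum_apply, Subring.coe_pow, Pi.pow_apply]
    congr 1
    refine Finset.sum_congr rfl fun l _ => ?_
    rw [Finset.mul_sum]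
    refine Finset.sum_congr rfl fun j _ => ?_
    change (a l).1 v.2 * (v.1 i ^ j * I (l - 1 - j) (updateCoord i 0 v)) =
      ((a l).1 v.2 * I (l - 1 - j) (updateCoord i 0 v)) * v.1 i ^ j
    ring
  rw [key]
  exact sum_mem fun l _ => sum_mem fun j _ =>
    AddSubgroup.subset_closure ⟨_, j, hfix l (l - 1 - j), rfl⟩

/-- Uniqueness of Weierstrass division in the ring of germs. -/
theorem eq_zero_of_division (hζ : φ.z ζ = 0) (i : Fin p) (P : (φ.baseRing ζ)[X]) (hP : P.Monic)
    (hP0 : ∀ l < P.natDegree, φ.baseValue ζ (P.coeff l) = 0) (q : HolRing E (ζ : X))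
    (r : ℕ → HolRing E (ζ : X)) (hr : ∀ l, φ.dropCoord hζ i (r l) = r l)
    (h : aeval (φ.zGerm ζ i) P * q = ∑ l ∈ Finset.range P.natDegree, r l * φ.zGerm ζ i ^ l) :
    q = 0 := by
  obtain ⟨Q, rfl⟩ := φ.ofModel_surjective ζ q
  obtain ⟨a, ha1, ha⟩ := φ.exists_coeff_repr P hP
  choose r' hr' using fun l => φ.ofModel_surjective ζ (r l)
  obtain rfl : (fun l => φ.ofModel ζ (r' l)) = r := funext hr'
  let a' : ℕ → holFun (φ.chart ζ) := fun l =>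
    holFun.comp (v := φ.chart ζ) Prod.snd differentiable_snd rfl (a l)
  rw [φ.aeval_zGerm_eq i P a ha] at h
  simp only [← ofModel_coordFun, ← map_mul, ← map_pow, ← map_sum] at h
  rw [ofModel_eq_iff] at h
  have hr0 : ∀ᶠ v in 𝓝 (φ.chart ζ), ∀ l ∈ Finset.range P.natDegree,
      (r' l).1 (updateCoord i 0 v) = (r' l).1 v := by
    refine (Finset.range P.natDegree).eventually_all.2 fun l _ => ?_
    have := hr l
    simp only [dropCoord_ofModel] at this
    rw [ofModel_eq_iff] at this
    exact this
  have ht := φ.tendsto_updateCoord hζ i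
  obtain ⟨hq0, -⟩ := eventually_eq_zero_of_weierstrass_division (m := P.natDegree)
    (q := fun u => Q.1 (updateCoord i u.1 u.2)) (y₀ := φ.chart ζ) (a := fun l => (a' l).1)
    (r := fun l v => (r' l).1 (updateCoord i 0 v))
    (by
      filter_upwards [ht.eventually Q.2] with u hu
      exact (hu.comp u (differentiable_updateCoord i u)).continuousAt)
    (fun l => (a' l).2.self_of_nhds.continuousAt)
    (fun l hl => by
      have := hP0 l hl
      rw [← ha, baseValue_baseGerm] at this
      exact this)
    (by simp only [a', ha1]; rfl)
    (by
      filter_upwards [ht.eventually (h.and hr0)] with u hu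
      obtain ⟨h1, h2⟩ := hu
      simp only [Subring.coe_mul, Pi.mul_apply,
        AddSubmonoidClass.coe_finsetSum, Finset.sum_apply, Subring.coe_pow, Pi.pow_apply] at h1
      have hc : (φ.coordFun ζ i).1 (updateCoord i u.1 u.2) = u.1 := Function.update_self _ _ _
      rw [hc] at h1
      refine h1.trans (Finset.sum_congr rfl fun l hl => ?_)
      rw [← h2 l hl, updateCoord_updateCoord])
  rw [ofModel_eq_zero_iff]
  have hz0 : (φ.chart ζ).1 i = 0 := congrFun hζ i
  have ht' : Tendsto (fun v : (Fin p → ℂ) × (Fin n → ℂ) => (v.1 i, v)) (𝓝 (φ.chart ζ))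
      (𝓝 (0, φ.chart ζ)) := by
    have hc : Continuous fun v : (Fin p → ℂ) × (Fin n → ℂ) => (v.1 i, v) := by fun_prop
    have := hc.tendsto (φ.chart ζ)
    rwa [hz0] at this
  filter_upwards [ht'.eventually hq0] with v hv
  simpa using hv

end HolCoordinates

end GermsInCoordinates

/-! ### The Koszul resolution of `𝒪_Z` -/

section Resolution

variable {E : Type*} [NormedAddCommGroup E] [NormedSpace ℂ E]
  {X : Type*} [TopologicalSpace X] [ChartedSpace E X] {p n : ℕ}

/-- For `c ≠ 0` the function `c - z_i` is invertible in `𝒪_Z` at points where `z_i` vanishes. -/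
theorem HolCoordinates.isUnit_const_sub (Z : AnalyticSubspace E X) (φ : HolCoordinates E X p n)
    {ζ : φ.chart.source} (hζ : φ.z ζ = 0) (i : Fin p) {c : ℂ} (hc : c ≠ 0) :
    IsUnit (algebraMap (φ.baseRing ζ) (Z.localRing (ζ : X))
      (φ.baseGerm ζ ⟨fun _ => c, Eventually.of_forall fun _ => differentiableAt_const c⟩) -
        algebraMap (HolRing E (ζ : X)) (Z.localRing (ζ : X)) (φ.zGerm ζ i)) := by
  rw [IsScalarTower.algebraMap_apply (φ.baseRing ζ) (HolRing E (ζ : X)) (Z.localRing (ζ : X)),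
    ← map_sub, φ.algebraMap_baseGerm, ← φ.ofModel_coordFun, ← map_sub]
  refine (φ.isUnit_ofModel _ ?_).map _
  have h0 : (φ.chart ζ).1 i = 0 := congrFun hζ i
  change c - (φ.chart ζ).1 i ≠ 0
  rwa [h0, sub_zero]

/-- The element `1 ⊗ c` of `A`. -/
noncomputable def ringA.oneTmul (Z : AnalyticSubspace E X) (φ : HolCoordinates E X p n)
    (ζ : φ.chart.source) (c : Z.localRing (ζ : X)) : ringA Z φ ζ :=
  (1 ⊗ₜ c : HolRing E (ζ : X) ⊗[φ.baseRing ζ] Z.localRing (ζ : X))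

theorem ringA.toLocalRing_tmul (Z : AnalyticSubspace E X) (φ : HolCoordinates E X p n)
    (ζ : φ.chart.source) (f : HolRing E (ζ : X)) (c : Z.localRing (ζ : X)) :
    ringA.toLocalRing Z φ ζ (f ⊗ₜ c : HolRing E (ζ : X) ⊗[φ.baseRing ζ] Z.localRing (ζ : X)) =
      algebraMap _ _ f * c := rfl

theorem ringA.toLocalRing_oneTmul (Z : AnalyticSubspace E X) (φ : HolCoordinates E X p n)
    (ζ : φ.chart.source) (c : Z.localRing (ζ : X)) :
    ringA.toLocalRing Z φ ζ (ringA.oneTmul Z φ ζ c) = c := by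
  refine (ringA.toLocalRing_tmul Z φ ζ 1 c).trans ?_
  rw [map_one, one_mul]

theorem ringA.augmentation_apply (Z : AnalyticSubspace E X) (φ : HolCoordinates E X p n)
    (ζ : φ.chart.source) (a : ringA Z φ ζ) :
    ringA.augmentation Z φ ζ a = ringA.toLocalRing Z φ ζ a :=
  mul_one (ringA.toLocalRing Z φ ζ a)

theorem ringA.toLocalRing_boldZ (Z : AnalyticSubspace E X) (φ : HolCoordinates E X p n)
    (ζ : φ.chart.source) (i : Fin p) : ringA.toLocalRing Z φ ζ (boldZ Z φ ζ i) = 0 := by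
  refine (map_sub (ringA.toLocalRing Z φ ζ) _ _).trans ?_
  rw [sub_eq_zero]
  refine (ringA.toLocalRing_tmul Z φ ζ (φ.zGerm ζ i) 1).trans ?_
  refine Eq.trans ?_ (ringA.toLocalRing_oneTmul Z φ ζ _).symm
  rw [mul_one]

/-- The monic equations of the `z_i` in `𝒪_Z` are Weierstrass polynomials, so division of germs
supplies all that `koszulDifferential_exact_tmul_sub` asks for. -/
theorem koszulDifferential_boldZ_exact (Z : AnalyticSubspace E X) (φ : HolCoordinates E X p n)
    {ζ : φ.chart.source} (hζ : φ.z ζ = 0) {ι : Type*} [Fintype ι]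
    (b : Module.Basis ι (φ.baseRing ζ) (Z.localRing (ζ : X))) :
    (∀ k, Function.Exact (koszulDifferential (boldZ Z φ ζ) (k + 1))
      (koszulDifferential (boldZ Z φ ζ) k)) ∧
    ∀ a : ringA Z φ ζ, ∃ c : Z.localRing (ζ : X),
      a - ringA.oneTmul Z φ ζ c ∈ Ideal.span (Set.range (boldZ Z φ ζ)) := by
  have := Module.Free.of_basis b
  have := Module.Finite.of_basis b
  choose P hP hPb hP0 using fun i => exists_monic_aeval_eq_zero (φ.baseValue ζ)
    (fun c => φ.baseGerm ζ ⟨fun _ => c, Eventually.of_forall fun _ => differentiableAt_const c⟩)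
    (fun c => rfl) (algebraMap (HolRing E (ζ : X)) (Z.localRing (ζ : X)) (φ.zGerm ζ i))
    (fun c hc => φ.isUnit_const_sub Z hζ i hc)
  exact koszulDifferential_exact_tmul_sub b (φ.zGerm ζ) _ (φ.dropCoord hζ) P hPb
    (fun i => φ.exists_division hζ i (P i) (hP i) (hP0 i))
    (fun i => φ.eq_zero_of_division hζ i (P i) (hP i) (hP0 i))
    (fun i j h => φ.dropCoord_zGerm hζ h) (φ.dropCoord_comm hζ) (φ.mem_range_of_dropCoord_eq hζ)

theorem zeroEquiv_koszulDifferential {A : Type*} [CommRing A] (x : Fin p → A)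
    (u : ⋀[A]^1 (Fin p → A)) :
    exteriorPower.zeroEquiv A (Fin p → A) (koszulDifferential x 0 u) =
      ∑ i, x i * exteriorPower.oneEquiv A (Fin p → A) u i := by
  have h : (exteriorPower.zeroEquiv A (Fin p → A)).toLinearMap ∘ₗ koszulDifferential x 0 =
      (∑ i, x i • LinearMap.proj i) ∘ₗ (exteriorPower.oneEquiv A (Fin p → A)).toLinearMap := by
    refine exteriorPower.linearMap_ext ?_
    ext v
    have hv : koszulDifferential x 0 (exteriorPower.ιMulti A 1 v) =
        (∑ i, x i * v 0 i) • exteriorPower.ιMulti A 0 0 := by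
      refine Subtype.ext ?_
      have h1 : ((exteriorPower.ιMulti A 1 v : ⋀[A]^1 (Fin p → A)) :
          ExteriorAlgebra A (Fin p → A)) = ExteriorAlgebra.ι A (v 0) := by
        simp [ExteriorAlgebra.ιMulti_apply]
      have h2 := CliffordAlgebra.contractLeft_ι (0 : QuadraticForm A (Fin p → A))
        (∑ i, x i • LinearMap.proj i) (v 0)
      refine (congrArg (koszulContr x) h1).trans (h2.trans ?_)
      simp [LinearMap.sum_apply, Algebra.algebraMap_eq_smul_one]
      exact Finset.sum_smul.symm
    simp [hv]
  have := LinearMap.congr_fun h u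
  simpa [LinearMap.sum_apply] using this

/-- Under the identifications of the first and zeroth exterior powers with `A^p` and `A`, the
differential is `c ↦ ∑ i, x i * c i`. -/
theorem range_koszulDifferential_zero {A : Type*} [CommRing A] (x : Fin p → A)
    (u : ⋀[A]^0 (Fin p → A)) :
    u ∈ Set.range (koszulDifferential x 0) ↔
      exteriorPower.zeroEquiv A (Fin p → A) u ∈ Ideal.span (Set.range x) := by
  constructor
  · rintro ⟨v, rfl⟩
    rw [zeroEquiv_koszulDifferential]
    exact sum_mem fun i _ => Ideal.mul_mem_right _ _ (Ideal.subset_span ⟨i, rfl⟩)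
  · intro h
    obtain ⟨c, hc⟩ := (Submodule.mem_span_range_iff_exists_fun A).1 h
    refine ⟨(exteriorPower.oneEquiv A (Fin p → A)).symm c, ?_⟩
    apply (exteriorPower.zeroEquiv A (Fin p → A)).injective
    rw [zeroEquiv_koszulDifferential, ← hc, LinearEquiv.apply_symm_apply]
    simp [mul_comm]

end Resolution

/-- `X` is a complex manifold of dimension `p + n`, `Z` an analytic subspace, `(z, w)` are
coordinates in which `Z_red = {z = 0}`, and `ζ` is a point of `Z_red` at which `𝒪_{Z,ζ}` is a free
`𝒪_{W,ζ}`-module with basis `z^{α^1}, …, z^{α^m}`. -/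
theorem theorem3p3 {p n : ℕ} {X : Type*} [TopologicalSpace X]
    [ChartedSpace (EuclideanSpace ℂ (Fin (p + n))) X]
    [IsManifold 𝓘(ℂ, EuclideanSpace ℂ (Fin (p + n))) 1 X]
    (Z : AnalyticSubspace (EuclideanSpace ℂ (Fin (p + n))) X)
    (φ : HolCoordinates (EuclideanSpace ℂ (Fin (p + n))) X p n)
    (hW : ∀ x ∈ φ.chart.source, x ∈ Z.zeroSet ↔ φ.z x = 0)
    (ζ : φ.chart.source) (hζ : (ζ : X) ∈ Z.zeroSet)
    {m : ℕ} (α : Fin m → Fin p → ℕ)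
    (b : Module.Basis (Fin m) (φ.baseRing ζ) (Z.localRing (ζ : X)))
    (hb : ∀ i, b i = algebraMap _ _ (φ.monomial ζ (α i))) :
    IsFreeResolution (ringA Z φ ζ)
      (fun k => ⋀[ringA Z φ ζ]^k (Fin p → ringA Z φ ζ))
      (koszulDifferential (boldZ Z φ ζ))
      (ringA.augmentation Z φ ζ ∘ₗ
        (exteriorPower.zeroEquiv (ringA Z φ ζ) (Fin p → ringA Z φ ζ)).toLinearMap) ∧
    IsFreeResolution (HolRing (EuclideanSpace ℂ (Fin (p + n))) (ζ : X))
      (fun k => ⋀[ringA Z φ ζ]^k (Fin p → ringA Z φ ζ))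
      (fun k => (koszulDifferential (boldZ Z φ ζ) k).restrictScalars _)
      ((ringA.augmentation Z φ ζ ∘ₗ
        (exteriorPower.zeroEquiv (ringA Z φ ζ) (Fin p → ringA Z φ ζ)).toLinearMap).restrictScalars
          (HolRing (EuclideanSpace ℂ (Fin (p + n))) (ζ : X))) := by
  have hz : φ.z ζ = 0 := (hW ζ ζ.2).1 hζ
  obtain ⟨hexact, hbase⟩ := koszulDifferential_boldZ_exact Z φ hz b
  have hker : ∀ a ∈ Ideal.span (Set.range (boldZ Z φ ζ)), ringA.toLocalRing Z φ ζ a = 0 := by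
    have hle : Ideal.span (Set.range (boldZ Z φ ζ)) ≤ RingHom.ker (ringA.toLocalRing Z φ ζ) := by
      rw [Ideal.span_le]
      rintro _ ⟨i, rfl⟩
      exact ringA.toLocalRing_boldZ Z φ ζ i
    exact fun a ha => hle ha
  have hres : IsFreeResolution (ringA Z φ ζ)
      (fun k => ⋀[ringA Z φ ζ]^k (Fin p → ringA Z φ ζ))
      (koszulDifferential (boldZ Z φ ζ))
      (ringA.augmentation Z φ ζ ∘ₗ
        (exteriorPower.zeroEquiv (ringA Z φ ζ) (Fin p → ringA Z φ ζ)).toLinearMap) := by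
    refine ⟨fun k => inferInstance, fun k => inferInstance, hexact, ?_, ?_⟩
    · intro u
      rw [range_koszulDifferential_zero, LinearMap.comp_apply, ringA.augmentation_apply,
        LinearEquiv.coe_coe]
      refine ⟨fun hu => ?_, hker _⟩
      -- Modulo the `𝐳_i` the element is `1 ⊗ c`. The augmentation kills the `𝐳_i` and maps `1 ⊗ c`
      -- to `c`, so `c = 0`.
      obtain ⟨c, hc⟩ := hbase (exteriorPower.zeroEquiv (ringA Z φ ζ) (Fin p → ringA Z φ ζ) u)
      have h := hker _ hc
      rw [map_sub, hu, ringA.toLocalRing_oneTmul, zero_sub, neg_eq_zero] at h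
      have h0 : ringA.oneTmul Z φ ζ 0 = 0 := TensorProduct.tmul_zero _ _
      rwa [h, h0, sub_zero] at hc
    · intro c
      refine ⟨(exteriorPower.zeroEquiv _ _).symm (ringA.oneTmul Z φ ζ c), ?_⟩
      rw [LinearMap.comp_apply, LinearEquiv.coe_coe, LinearEquiv.apply_symm_apply,
        ringA.augmentation_apply, ringA.toLocalRing_oneTmul]
  -- Exactness and surjectivity do not depend on the scalars. Freeness and finiteness over `𝒪_X`
  -- follow by transitivity through `A`.
  have hfree : Module.Free (HolRing (EuclideanSpace ℂ (Fin (p + n))) (ζ : X)) (ringA Z φ ζ) :=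
    Module.Free.of_basis (Algebra.TensorProduct.basis _ b)
  have hfin : Module.Finite (HolRing (EuclideanSpace ℂ (Fin (p + n))) (ζ : X)) (ringA Z φ ζ) :=
    Module.Finite.of_basis (Algebra.TensorProduct.basis _ b)
  exact ⟨hres, fun k => Module.Free.trans (S := ringA Z φ ζ),
    fun k => Module.Finite.trans (ringA Z φ ζ) _, hres.exact, hres.exact_zero, hres.surjective⟩
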